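/- **Setting.** For $0\le\epsilon\le 1$ let $\omega$ be uniform on $\{-1,1\}^n$ and let $\omega^\epsilon$ arise from $\omega$ by flipping each coordinate independently with probability $\epsilon$. Let $h_n:\{-1,1\}^n\to\{-1,1\}$ and $T_n\in\{0,1,2,\dots\}$. Let $\theta_1,\dots,\theta_{T_n}$ be independent $n\times n$ matrices with i.i.d. $N(0,1)$ entries, independent of $(\omega,\omega^\epsilon)$; for $\omega_0\in\{-1,1\}^n$ put $\omega_t=\operatorname{sign}(\theta_t\omega_{t-1})$ coordinatewise, $t=1,\dots,T_n$, and $f_{n,T_n}(\omega_0)=h_n(\omega_{T_n})$. Let $\pi_n$ be the law of the random Boolean function $f_{n,T_n}$. **Definitions.** For a sequence of random Boolean functions $f_n$ with laws $\pi_n$, independent of $(\omega,\omega^\epsilon)$: * $\{f_n\}$ is *annealed QNS at level $\{\epsilon_n\}$* if $\mathrm{Cov}(f_n(\omega),f_n(\omega^{\epsilon_n}))\to 0$, the covariance being taken over $f_n,\omega,\omega^{\epsilon_n}$ jointly; it is *annealed noise sensitive* if for every fixed $0<\epsilon\le 1/2$ the joint covariance $\mathrm{Cov}(f_n(\omega),f_n(\omega^{\epsilon}))\to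 0$. * $\{f_n\}$ is *quenched QNS at level $\{\epsilon_n\}$* if for every $\delta>0$ there is $N$ such that for all $n\ge N$, $\pi_n\{f:\mathrm{Cov}_{\omega,\omega^{\epsilon_n}}(f(\omega),f(\omega^{\epsilon_n}))\le\delta\}\ge 1-\delta$. * $\{f_n\}$ is *annealed noise stable* if $\lim_{\epsilon\downarrow0}\sup_n \mathrm P(f_n(\omega)\ne f_n(\omega^\epsilon))=0$ (probability over $f_n,\omega,\omega^\epsilon$ jointly); it is *quenched noise stable* if for every $\delta>0$ there is $0<\epsilon\le1/2$ such that for all $n$, $\pi_n\{f:\mathrm P_{\omega,\omega^\epsilon}(f(\omega)\ne f(\omega^\epsilon))<\delta\}\ge1-\delta$. A deterministic sequence $\{h_n\}$ is *noise stable* if $\lim_{\epsilon\downarrow0}\sup_n\mathrm P(h_n(\omega)\ne h_n(\omega^\epsilon))=0$. **Theorem.** Let $\epsilon_n\le 1/2$ be non-increasing with $\epsilon_n\to0$ and $n\epsilon_n\to\infty$, and let $K_n$ be real numbers with $K_n/\log(1/\epsilon_n)\to\infty$. Then 1. if $b_n\to0$, $nb_n\to\infty$ and $K_n\le T_n\le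 e^{b_nn}$ for all large $n$, then for any Boolean functions $\{h_n\}$, $\{f_{n,T_n}\}$ is annealed QNS at level $\{\epsilon_n\}$; 2. if $h_n$ is odd (that is, $h_n(-\omega)=-h_n(\omega)$) for all $n\ge1$ and $T_n\ge K_n$ for all large $n$, then $\{f_{n,T_n}\}$ is annealed QNS at level $\{\epsilon_n\}$; 3. if $T_n\ge K_n$ for all large $n$, then for any $\{h_n\}$, $\{f_{n,T_n}\}$ is quenched QNS at level $\{\epsilon_n\}$. Moreover, independently of $\{\epsilon_n\}$ and $\{K_n\}$, 4. there are Boolean functions $\{h_n\}$ and integers $\{\tau_n\}$ such that, whenever $T_n\ge\tau_n$ for all large $n$, $\{f_{n,T_n}\}$ is not annealed noise sensitive; 5. if $\{h_n\}$ is noise stable and $T_n$ is bounded, then $\{f_{n,T_n}\}$ is annealed noise stable and quenched noise stable. -/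

import Mathlib

open Filter Topology MeasureTheory ProbabilityTheory

noncomputable section

namespace SignNetwork

/-- The Boolean cube `{-1, 1}^n`; the two-point set `{-1, 1}` is `ℤˣ`. -/
abbrev Cube (n : ℕ) : Type := Fin n → ℤˣ

/-- Boolean functions `{-1, 1}^n → {-1, 1}`. -/
abbrev BoolFun (n : ℕ) : Type := Cube n → ℤˣ

/-- The element `-1` or `1` of `{-1, 1}` as a real number. -/
def toReal (u : ℤˣ) : ℝ := ((u : ℤ) : ℝ)

instance : MeasurableSingletonClass ℤˣ :=
  ⟨fun u => ⟨{(u : ℤ)}, measurableSet_singleton _, by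
    ext v; simp only [Set.mem_preimage, Set.mem_singleton_iff]; exact Units.val_inj⟩⟩

/-! ### Input and noise -/

/-- The law on `{-1, 1}` giving mass `1 - ε` to `1` and mass `ε` to `-1` (for `0 ≤ ε ≤ 1`). -/
def flipLaw (ε : ℝ) : Measure ℤˣ :=
  ENNReal.ofReal (1 - ε) • Measure.dirac 1 + ENNReal.ofReal ε • Measure.dirac (-1)

/-- The joint law of `(ω, ω^ε)`: `ω` is uniform on the cube, and `ω^ε` arises from `ω` by
multiplying every coordinate, independently, by a sign that is `-1` with probability `ε`. -/
def noisePair (n : ℕ) (ε : ℝ) : Measure (Cube n × Cube n) :=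
  ((Measure.pi fun _ : Fin n => flipLaw (1 / 2)).prod (Measure.pi fun _ : Fin n => flipLaw ε)).map
    fun p => (p.1, p.1 * p.2)

/-! ### Noise sensitivity and noise stability

`h` is a deterministic sequence of Boolean functions, `π` a sequence of laws of random Boolean
functions. -/

/-- `lim_{ε ↓ 0} sup_n P(h_n(ω) ≠ h_n(ω^ε)) = 0`. -/
def NoiseStable (h : ∀ n, BoolFun n) : Prop :=
  Tendsto (fun ε : ℝ => ⨆ n, noisePair n ε {p | h n p.1 ≠ h n p.2}) (𝓝[>] 0) (𝓝 0)

/-- `Cov(f(ω), f(ω^ε))` for a fixed Boolean function `f`. -/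
def noiseCov {n : ℕ} (f : BoolFun n) (ε : ℝ) : ℝ :=
  cov[fun p : Cube n × Cube n => toReal (f p.1), fun p => toReal (f p.2); noisePair n ε]

/-- `Cov(f(ω), f(ω^ε))` where `f` has law `π` and is independent of `(ω, ω^ε)`, the covariance
being taken over `f`, `ω` and `ω^ε` together. -/
def annealedCov {n : ℕ} (π : Measure (BoolFun n)) (ε : ℝ) : ℝ :=
  cov[fun q : BoolFun n × Cube n × Cube n => toReal (q.1 q.2.1),
    fun q => toReal (q.1 q.2.2); π.prod (noisePair n ε)]

/-- Annealed quantitative noise sensitivity at level `ε`. -/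
def AnnealedQNS (π : ∀ n, Measure (BoolFun n)) (ε : ℕ → ℝ) : Prop :=
  Tendsto (fun n => annealedCov (π n) (ε n)) atTop (𝓝 0)

/-- Quenched quantitative noise sensitivity at level `ε`. -/
def QuenchedQNS (π : ∀ n, Measure (BoolFun n)) (ε : ℕ → ℝ) : Prop :=
  ∀ δ : ℝ, 0 < δ → ∃ N : ℕ, ∀ n ≥ N, 1 - δ ≤ (π n).real {f | noiseCov f (ε n) ≤ δ}

/-- Annealed noise sensitivity: the noise level `ε` is fixed as `n → ∞`. -/
def AnnealedNoiseSensitive (π : ∀ n, Measure (BoolFun n)) : Prop :=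
  ∀ ε : ℝ, 0 < ε → ε ≤ 1 / 2 → Tendsto (fun n => annealedCov (π n) ε) atTop (𝓝 0)

/-- Annealed noise stability. -/
def AnnealedNoiseStable (π : ∀ n, Measure (BoolFun n)) : Prop :=
  Tendsto (fun ε : ℝ => ⨆ n, ((π n).prod (noisePair n ε)) {q | q.1 q.2.1 ≠ q.1 q.2.2})
    (𝓝[>] 0) (𝓝 0)

/-- Quenched noise stability. -/
def QuenchedNoiseStable (π : ∀ n, Measure (BoolFun n)) : Prop :=
  ∀ δ : ℝ, 0 < δ → ∃ ε : ℝ, 0 < ε ∧ ε ≤ 1 / 2 ∧ ∀ n,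
    1 - δ ≤ (π n).real {f | (noisePair n ε).real {p | f p.1 ≠ f p.2} < δ}

/-! ### The network -/

/-- The sign activation. The value at `0` only matters on a null event of weights. -/
def sgn (x : ℝ) : ℤˣ := if 0 ≤ x then 1 else -1

/-- Weight matrices of a layer of width `n`; `θ i j` is the weight from node `j` to node `i`. -/
abbrev Weights (n : ℕ) : Type := Fin n → Fin n → ℝ

/-- One fully connected layer without bias: `ω ↦ sign(θ ω)`, coordinatewise. -/
def layer {n : ℕ} (θ : Weights n) (ω : Cube n) : Cube n :=
  fun i => sgn (∑ j, θ i j * toReal (ω j))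

/-- The state `ω_T` after `T` layers: `ω_0 = ω` and `ω_{t+1} = sign(θ_{t+1} ω_t)`.
The weight matrix `θ_{t+1}` is stored at index `t`. -/
def state {n : ℕ} : (T : ℕ) → (Fin T → Weights n) → Cube n → Cube n
  | 0, _, ω => ω
  | T + 1, θ, ω => layer (θ (Fin.last T)) (state T (fun t => θ t.castSucc) ω)

/-- The Boolean function `f(ω) = h(ω_T)` represented by the network. -/
def netFun {n : ℕ} (T : ℕ) (h : BoolFun n) (θ : Fin T → Weights n) : BoolFun n :=
  fun ω => h (state T θ ω)

/-- The law of one weight matrix with i.i.d. standard normal entries. -/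
def matrixLaw (n : ℕ) : Measure (Weights n) :=
  Measure.pi fun _ : Fin n => Measure.pi fun _ : Fin n => gaussianReal 0 1

/-- The law of `T` independent such weight matrices. -/
def weightLaw (n T : ℕ) : Measure (Fin T → Weights n) :=
  Measure.pi fun _ : Fin T => matrixLaw n

theorem measurable_state {n : ℕ} (T : ℕ) (ω : Cube n) :
    Measurable fun θ : Fin T → Weights n => state T θ ω := by
  induction T with
  | zero => exact measurable_const
  | succ T ih =>
    refine measurable_pi_lambda _ fun i =>
      (Measurable.ite measurableSet_Ici measurable_const measurable_const :
        Measurable sgn).comp ?_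
    refine Finset.measurable_sum _ fun j _ => Measurable.mul (by fun_prop) ?_
    refine (measurable_of_countable toReal).comp ((measurable_pi_apply j).comp ?_)
    exact ih.comp (measurable_pi_lambda _ fun t => measurable_pi_apply _)

/-- Measurability makes the image measure below the genuine law. -/
theorem measurable_netFun {n : ℕ} (T : ℕ) (h : BoolFun n) :
    Measurable (netFun T h : (Fin T → Weights n) → BoolFun n) :=
  measurable_pi_lambda _ fun ω => (measurable_of_countable h).comp (measurable_state T ω)

/-- The law of the random Boolean function `f_{n,T}` with output function `h`. -/
def netLaw {n : ℕ} (T : ℕ) (h : BoolFun n) : Measure (BoolFun n) :=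
  (weightLaw n T).map (netFun T h)

end SignNetwork

end

open SignNetwork

noncomputable section

namespace SignNetwork

/-! ### A planar Gaussian sector -/

/-! Everything reduces to a Markov chain on the cube. For two inputs `ω`, `ω'` the sums of signed
weights over the coordinates where they agree and where they disagree are independent centred
Gaussians `A`, `B`; a node sees `A + B` and `A - B`, so it separates the inputs exactly when `|A| <
|B|`, up to null events. This has probability `phi x = arccos (1 - 2x) / π`, with `x` the relative
Hamming distance. Rows are independent, so a layer turns any pair into a uniform point with a noisy
copy at level `phi x` (`matrixLaw_map_layer_pair`). The quotient `D = ω * ω'` is thus a Markov chain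
with transitions `flips n (phi (frac D))`, and covariances are chain expectations of the
autocorrelation `corr h`.

The map `phi` fixes `0`, `1/2`, `1`. Since `phi x ≥ (2/π) √x`, the point `0` repels; on `[7/100,
93/100]` the bias `1 - 2x` contracts by `4/5`. With `n ε_n → ∞` concentration lets the chain follow
`phi`: the distance enters this window within `O(log (1/ε_n))` steps, leaves it with exponentially
small probability per step, and the bias becomes small in a bounded number of further steps
(`chainExp_abs_bias_le`).

The decisive comparison, `abs_chainExp_corr_sub_half_le`, is uniform in the remaining depth `k`:
restarting at level `1/2` costs at most the mean absolute bias, because the error is an average of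
quenched covariances, each at most `|1 - 2p|` by Walsh expansion. For arbitrary `h` and depth at
most `e^{b_n n}` take `k = 0`, where the restarted chain gives the squared mean of `h`. For odd `h`
the restarted expectation vanishes by symmetry. For quenched sensitivity the starts `ε_n` and `1/2`
are compared with the same restarted chain; quenched covariances are nonnegative and Markov's
inequality applies.

The points `1` and `-1` are absorbing and one of them is reached with probability at least `2^{-n}`
per step, so at huge depth an even balanced `h` has annealed covariance near `1`. At bounded depth,
`phi x ≤ √x` keeps small distances small. -/

theorem volume_angle_sector {α : ℝ} (h0 : 0 ≤ α) (h1 : α ≤ Real.pi / 2) :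
    volume ({θ : ℝ | Real.cos α * |Real.cos θ| < Real.sin α * |Real.sin θ|} ∩
      Set.Ioo (-Real.pi) Real.pi) = ENNReal.ofReal (4 * α) := by
  have hpi := Real.pi_pos
  have hset : {θ : ℝ | Real.cos α * |Real.cos θ| < Real.sin α * |Real.sin θ|} ∩
      Set.Ioo (-Real.pi) Real.pi =
      Set.Ioo (Real.pi / 2 - α) (Real.pi / 2 + α) ∪
        Set.Ioo (-(Real.pi / 2) - α) (-(Real.pi / 2) + α) := by
    have hca : 0 ≤ Real.cos α := Real.cos_nonneg_of_mem_Icc ⟨by linarith, h1⟩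
    have hsa : 0 ≤ Real.sin α := Real.sin_nonneg_of_nonneg_of_le_pi h0 (by linarith)
    -- Squaring and using `sin² + cos² = 1` on both angles leaves a condition on `|cos θ|` alone,
    -- which cuts out an arc of width `2α` around each of `±π/2`.
    have key : ∀ θ : ℝ, (Real.cos α * |Real.cos θ| < Real.sin α * |Real.sin θ|) ↔
        |Real.cos θ| < Real.sin α := by
      intro θ
      rw [← sq_lt_sq₀ (by positivity) (by positivity), ← sq_lt_sq₀ (abs_nonneg _) hsa,
        mul_pow, mul_pow, sq_abs, sq_abs]
      have e1 := Real.sin_sq_add_cos_sq α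
      have e2 := Real.sin_sq_add_cos_sq θ
      have : Real.cos α ^ 2 * Real.cos θ ^ 2 - Real.sin α ^ 2 * Real.sin θ ^ 2 =
        Real.cos θ ^ 2 - Real.sin α ^ 2 := by
        rw [show Real.sin θ ^ 2 = 1 - Real.cos θ ^ 2 by linarith,
          show Real.cos α ^ 2 = 1 - Real.sin α ^ 2 by linarith]; ring
      constructor <;> intro h <;> linarith
    have key2 : ∀ t : ℝ, 0 ≤ t → t ≤ Real.pi → (|Real.cos t| < Real.sin α ↔
        Real.pi / 2 - α < t ∧ t < Real.pi / 2 + α) := by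
      intro t ht0 ht1
      rw [abs_lt, ← Real.cos_pi_div_two_sub α, neg_lt, ← Real.cos_pi_sub t,
        Real.strictAntiOn_cos.lt_iff_gt ⟨ht0, ht1⟩ ⟨by linarith, by linarith⟩,
        Real.strictAntiOn_cos.lt_iff_gt ⟨by linarith, by linarith⟩ ⟨by linarith, by linarith⟩]
      constructor <;> rintro ⟨h, h'⟩ <;> constructor <;> linarith
    ext θ
    simp only [Set.mem_inter_iff, Set.mem_ofPred_eq, Set.mem_Ioo, Set.mem_union, key]
    rcases le_total 0 θ with h | h
    · constructor
      · rintro ⟨h2, h3, h4⟩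
        exact Or.inl ((key2 θ h h4.le).1 h2)
      · rintro (h2 | h2)
        · exact ⟨(key2 θ h (by linarith)).2 h2, by linarith, by linarith⟩
        · linarith
    · rw [← Real.cos_neg θ]
      constructor
      · rintro ⟨h2, h3, h4⟩
        have := (key2 (-θ) (by linarith) (by linarith)).1 h2
        exact Or.inr ⟨by linarith, by linarith⟩
      · rintro (h2 | h2)
        · linarith
        · exact ⟨(key2 (-θ) (by linarith) (by linarith)).2 ⟨by linarith, by linarith⟩,
            by linarith, by linarith⟩
  rw [hset, measure_union _ measurableSet_Ioo, Real.volume_Ioo, Real.volume_Ioo,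
    ← ENNReal.ofReal_add (by linarith) (by linarith)]
  · congr 1; ring
  · rw [Set.disjoint_left]
    rintro x ⟨hx, -⟩ ⟨-, hx'⟩
    linarith

/-- The mass the standard planar Gaussian gives to a cone is proportional to its angle. -/
theorem gaussian_prod_polar_set {A : Set ℝ} (hA : MeasurableSet A) {S : Set (ℝ × ℝ)}
    (hS : MeasurableSet S)
    (hSA : ∀ r θ : ℝ, 0 < r → ((r * Real.cos θ, r * Real.sin θ) ∈ S ↔ θ ∈ A)) :
    ((gaussianReal 0 1).prod (gaussianReal 0 1)) S =
      (∫⁻ r in Set.Ioi (0 : ℝ), ENNReal.ofReal r *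
        ENNReal.ofReal ((2 * Real.pi)⁻¹ * Real.exp (-r ^ 2 / 2))) *
        volume (A ∩ Set.Ioo (-Real.pi) Real.pi) := by
  have hpi := Real.pi_pos
  rw [gaussianReal_of_var_ne_zero 0 one_ne_zero,
    prod_withDensity (measurable_gaussianPDF 0 1) (measurable_gaussianPDF 0 1),
    withDensity_apply _ hS, ← lintegral_indicator hS, ← Measure.volume_eq_prod,
    ← lintegral_comp_polarCoord_symm]
  have hvol : volume (A ∩ Set.Ioo (-Real.pi) Real.pi) =
      ∫⁻ θ in Set.Ioo (-Real.pi) Real.pi, A.indicator 1 θ := by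
    rw [lintegral_indicator_one hA, Measure.restrict_apply hA]
  rw [hvol, ← lintegral_prod_mul (by fun_prop) (by
    exact (measurable_one.indicator hA).aemeasurable), Measure.prod_restrict,
    ← Measure.volume_eq_prod]
  refine setLIntegral_congr_fun (measurableSet_Ioi.prod measurableSet_Ioo) ?_
  rintro ⟨r, θ⟩ ⟨hr, hθ⟩
  simp only [Set.mem_Ioi] at hr
  simp only [polarCoord_symm_apply, smul_eq_mul]
  by_cases h : θ ∈ A
  · rw [Set.indicator_of_mem ((hSA r θ hr).2 h), Set.indicator_of_mem h]
    simp only [Pi.one_apply, mul_one]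
    congr 1
    rw [gaussianPDF, gaussianPDF, ← ENNReal.ofReal_mul (gaussianPDFReal_nonneg _ _ _)]
    congr 1
    simp only [gaussianPDFReal, sub_zero, NNReal.coe_one, mul_one]
    rw [mul_mul_mul_comm, ← mul_inv, Real.mul_self_sqrt (by positivity), ← Real.exp_add]
    congr 2
    have := Real.sin_sq_add_cos_sq θ
    rw [mul_pow, mul_pow, show Real.sin θ ^ 2 = 1 - Real.cos θ ^ 2 by linarith]
    ring
  · rw [Set.indicator_of_notMem (fun h' => h ((hSA r θ hr).1 h')), Set.indicator_of_notMem h]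
    simp

theorem gaussian_prod_cone {α : ℝ} (h0 : 0 ≤ α) (h1 : α ≤ Real.pi / 2) :
    ((gaussianReal 0 1).prod (gaussianReal 0 1))
      {z : ℝ × ℝ | Real.cos α * |z.1| < Real.sin α * |z.2|} = ENNReal.ofReal (2 * α / Real.pi) := by
  have hpi := Real.pi_pos
  have hm1 : MeasurableSet {z : ℝ × ℝ | Real.cos α * |z.1| < Real.sin α * |z.2|} :=
    measurableSet_lt (by fun_prop) (by fun_prop)
  have hm2 : MeasurableSet {θ : ℝ | Real.cos α * |Real.cos θ| < Real.sin α * |Real.sin θ|} :=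
    measurableSet_lt (by fun_prop) (by fun_prop)
  -- The radial integral is never evaluated: the whole plane, of angle `2π` and mass `1`, fixes its
  -- value.
  have htot := gaussian_prod_polar_set (A := Set.univ) (S := Set.univ) MeasurableSet.univ
    MeasurableSet.univ (by simp)
  rw [measure_univ, Set.univ_inter, Real.volume_Ioo] at htot
  rw [gaussian_prod_polar_set hm2 hm1, volume_angle_sector h0 h1]
  · have h4 : ENNReal.ofReal (4 * α) =
        ENNReal.ofReal (Real.pi - -Real.pi) * ENNReal.ofReal (2 * α / Real.pi) := by
      rw [← ENNReal.ofReal_mul (by linarith)]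
      congr 1
      field_simp
      ring
    rw [h4, ← mul_assoc, ← htot, one_mul]
  · intro r θ hr
    simp only [Set.mem_ofPred_eq, abs_mul, abs_of_pos hr]
    rw [mul_left_comm, mul_left_comm (Real.sin α), mul_lt_mul_iff_right₀ hr]

/-! ### Signed sums of independent Gaussians -/

theorem toReal_one : toReal 1 = 1 := by simp [toReal]

theorem toReal_neg_one : toReal (-1) = -1 := by simp [toReal]

theorem toReal_mul (u v : ℤˣ) : toReal (u * v) = toReal u * toReal v := by simp [toReal]

theorem toReal_neg (u : ℤˣ) : toReal (-u) = -toReal u := by simp [toReal]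

theorem toReal_mul_self (u : ℤˣ) : toReal u * toReal u = 1 := by
  rcases Int.units_eq_one_or u with rfl | rfl <;> simp [toReal]

/-- The law of a row of weights. -/
def rowLaw (n : ℕ) : Measure (Fin n → ℝ) := Measure.pi fun _ => gaussianReal 0 1

instance (n : ℕ) : IsProbabilityMeasure (rowLaw n) := by unfold rowLaw; infer_instance

theorem gaussianReal_map_toReal_mul (u : ℤˣ) :
    (gaussianReal 0 1).map (fun x => x * toReal u) = gaussianReal 0 1 := by
  rw [gaussianReal_map_mul_const]
  rcases Int.units_eq_one_or u with rfl | rfl <;> simp [toReal]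

theorem iIndepFun_signed (n : ℕ) (ω : Cube n) :
    iIndepFun (fun (i : Fin n) (g : Fin n → ℝ) => g i * toReal (ω i)) (rowLaw n) :=
  iIndepFun_pi (X := fun i (x : ℝ) => x * toReal (ω i)) fun i => by fun_prop

theorem map_signed_sum {n : ℕ} (ω : Cube n) (s : Finset (Fin n)) :
    (rowLaw n).map (fun g => ∑ i ∈ s, g i * toReal (ω i)) = gaussianReal 0 (s.card : NNReal) := by
  classical
  induction s using Finset.induction_on with
  | empty => simp
  | insert a s ha ih =>
    have hind := (iIndepFun_signed n ω).indepFun_finsetSum_of_notMem (fun i => by fun_prop) ha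
    have h1 : (rowLaw n).map (fun g => g a * toReal (ω a)) = gaussianReal 0 1 := by
      rw [← gaussianReal_map_toReal_mul (ω a)]
      have := (measurePreserving_eval (fun _ : Fin n => gaussianReal 0 1) a).map_eq
      conv_rhs => rw [← this]
      rw [Measure.map_map (by fun_prop) (by fun_prop)]
      rfl
    have h2 := gaussianReal_add_gaussianReal_of_indepFun hind (by
      convert ih using 2; ext g; simp) h1
    simp only [Finset.sum_insert ha, Finset.card_insert_of_notMem ha]
    convert h2 using 1
    · congr 1; ext g; simp [add_comm]
    · simp

theorem map_signed_sum_pair {n : ℕ} (ω : Cube n) (s t : Finset (Fin n)) (hst : Disjoint s t) :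
    (rowLaw n).map (fun g => (∑ i ∈ s, g i * toReal (ω i), ∑ i ∈ t, g i * toReal (ω i))) =
      (gaussianReal 0 (s.card : NNReal)).prod (gaussianReal 0 (t.card : NNReal)) := by
  have h := (iIndepFun_signed n ω).indepFun_finset s t hst (fun i => by fun_prop)
  have h2 : IndepFun (fun g : Fin n → ℝ => ∑ i ∈ s, g i * toReal (ω i))
      (fun g => ∑ i ∈ t, g i * toReal (ω i)) (rowLaw n) := by
    have h3 := h.comp (φ := fun x : s → ℝ => ∑ i, x i) (ψ := fun x : t → ℝ => ∑ i, x i)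
      (by fun_prop) (by fun_prop)
    convert h3 using 1
    · ext g; simp [Finset.sum_attach s (fun i => g i * toReal (ω i))]
    · ext g; simp [Finset.sum_attach t (fun i => g i * toReal (ω i))]
  rw [(indepFun_iff_map_prod_eq_prod_map_map
    (Measurable.aemeasurable (by fun_prop)) (Measurable.aemeasurable (by fun_prop))).1 h2,
    map_signed_sum, map_signed_sum]

/-! ### One layer acting on a pair of inputs -/

/-- The fraction of coordinates equal to `-1`. -/
def frac {n : ℕ} (D : Cube n) : ℝ := ((Finset.univ.filter fun i => D i = -1).card : ℝ) / n

/-- The probability that two Gaussian half spaces separate points at relative Hamming distance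
`x`. -/
def phi (x : ℝ) : ℝ := Real.arccos (1 - 2 * x) / Real.pi

theorem frac_nonneg {n : ℕ} (D : Cube n) : 0 ≤ frac D := by unfold frac; positivity

theorem frac_le_one {n : ℕ} (D : Cube n) : frac D ≤ 1 := by
  unfold frac
  apply div_le_one_of_le₀ _ (by positivity)
  exact_mod_cast (Finset.card_le_univ _).trans (by simp)

theorem phi_nonneg (x : ℝ) : 0 ≤ phi x := div_nonneg (Real.arccos_nonneg _) Real.pi_pos.le

theorem phi_le_one (x : ℝ) : phi x ≤ 1 :=
  div_le_one_of_le₀ (Real.arccos_le_pi _) Real.pi_pos.le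

theorem phi_zero : phi 0 = 0 := by simp [phi]

theorem phi_one : phi 1 = 1 := by
  unfold phi; norm_num [Real.arccos_neg_one, Real.pi_ne_zero]

/-- Half-angle form of `phi`: `π * phi x / 2` is the opening angle of the relevant Gaussian cone,
and bounds on `phi` become elementary bounds on the sine. -/
theorem sin_half_pi_mul_phi {x : ℝ} (h0 : 0 ≤ x) (h1 : x ≤ 1) :
    Real.sin (Real.pi * phi x / 2) = √x := by
  have hpi := Real.pi_pos
  have e : Real.pi * phi x / 2 = Real.arccos (1 - 2 * x) / 2 := by
    unfold phi; field_simp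
  rw [e, Real.sin_half_eq_sqrt (Real.arccos_nonneg _)
    (by linarith [Real.arccos_le_pi (1 - 2 * x)]),
    Real.cos_arccos (by linarith) (by linarith)]
  congr 1; ring

theorem cos_half_pi_mul_phi {x : ℝ} (h0 : 0 ≤ x) (h1 : x ≤ 1) :
    Real.cos (Real.pi * phi x / 2) = √(1 - x) := by
  have hpi := Real.pi_pos
  have e : Real.pi * phi x / 2 = Real.arccos (1 - 2 * x) / 2 := by
    unfold phi; field_simp
  rw [e, Real.cos_half (by linarith [Real.arccos_nonneg (1 - 2 * x)])
    (Real.arccos_le_pi (1 - 2 * x)),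
    Real.cos_arccos (by linarith) (by linarith)]
  congr 1; ring

theorem gaussianReal_eq_map_sqrt (v : NNReal) :
    gaussianReal 0 v = (gaussianReal 0 1).map (fun x => √(v : ℝ) * x) := by
  rw [gaussianReal_map_const_mul]
  congr 1
  · simp
  · ext; simp

/-- Rescaling both coordinates to unit variance gives a cone whose angle has cosine `√(l/n)` and
sine `√(k/n)`. -/
theorem gaussian_prod_abs_lt {n k l : ℕ} (hn : 0 < n) (hkl : l + k = n) :
    ((gaussianReal 0 (l : NNReal)).prod (gaussianReal 0 (k : NNReal)))
      {z : ℝ × ℝ | |z.1| < |z.2|} = ENNReal.ofReal (phi ((k : ℝ) / n)) := by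
  have hn' : (0 : ℝ) < n := by exact_mod_cast hn
  have hkl' : (l : ℝ) + k = n := by exact_mod_cast hkl
  have hpi := Real.pi_pos
  have h0 : (0 : ℝ) ≤ (k : ℝ) / n := by positivity
  have h1 : (k : ℝ) / n ≤ 1 := by
    rw [div_le_one hn']; linarith [(Nat.cast_nonneg l : (0 : ℝ) ≤ l)]
  rw [gaussianReal_eq_map_sqrt l, gaussianReal_eq_map_sqrt k,
    Measure.map_prod_map _ _ (by fun_prop) (by fun_prop),
    Measure.map_apply (by fun_prop) (measurableSet_lt (by fun_prop) (by fun_prop))]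
  have hc := gaussian_prod_cone (α := Real.pi * phi ((k : ℝ) / n) / 2)
    (by have := phi_nonneg ((k : ℝ) / n); positivity)
    (by have := phi_le_one ((k : ℝ) / n); nlinarith)
  rw [sin_half_pi_mul_phi h0 h1, cos_half_pi_mul_phi h0 h1] at hc
  convert hc using 2
  · ext z
    simp only [Set.mem_preimage, Set.mem_ofPred_eq, Prod.map, NNReal.coe_natCast, abs_mul,
      abs_of_nonneg (Real.sqrt_nonneg _)]
    have e1 : √(l : ℝ) = √(n : ℝ) * √(1 - k / n) := by
      rw [← Real.sqrt_mul hn'.le]; congr 1; field_simp; linarith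
    have e2 : √(k : ℝ) = √(n : ℝ) * √((k : ℝ) / n) := by
      rw [← Real.sqrt_mul hn'.le]; congr 1; field_simp
    rw [e1, e2, mul_assoc, mul_assoc, mul_lt_mul_iff_right₀ (Real.sqrt_pos.2 hn')]
  · field_simp

/-- The preactivation of a node. -/
def dot {n : ℕ} (ω : Cube n) (g : Fin n → ℝ) : ℝ := ∑ j, g j * toReal (ω j)

theorem measurable_dot {n : ℕ} (ω : Cube n) : Measurable (dot ω) := by
  unfold dot; fun_prop

theorem measurable_sgn : Measurable sgn :=
  Measurable.ite measurableSet_Ici measurable_const measurable_const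

theorem sgn_neg {x : ℝ} (hx : x ≠ 0) : sgn (-x) = -sgn x := by
  unfold sgn
  rcases lt_or_gt_of_ne hx with h | h
  · rw [if_pos (by linarith), if_neg (by linarith)]; simp
  · rw [if_neg (by linarith), if_pos (by linarith)]

theorem dot_ne_zero_ae {n : ℕ} (hn : 0 < n) (ω : Cube n) : ∀ᵐ g ∂rowLaw n, dot ω g ≠ 0 := by
  have h := map_signed_sum ω Finset.univ
  have hv : ((Finset.univ : Finset (Fin n)).card : NNReal) ≠ 0 := by
    simpa using hn.ne'
  have : NullSingletonClass (gaussianReal 0 ((Finset.univ : Finset (Fin n)).card : NNReal)) :=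
    nullSingletonClass_gaussianReal hv
  have h2 : (rowLaw n).map (dot ω) {0} = 0 := by
    unfold dot; rw [h]; exact measure_singleton 0
  rw [Measure.map_apply (measurable_dot ω) (measurableSet_singleton _)] at h2
  rw [ae_iff]
  convert h2 using 2
  ext g; simp

/-- With `a`, `b` the sums over agreeing and disagreeing coordinates, the preactivations are `a + b`
and `a - b`; off a null set their signs differ iff `|a| < |b|`. -/
theorem rowLaw_sgn_ne {n : ℕ} (hn : 0 < n) (ω ω' : Cube n) :
    rowLaw n {g | sgn (dot ω g) ≠ sgn (dot ω' g)} = ENNReal.ofReal (phi (frac (ω * ω'))) := by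
  classical
  set B := Finset.univ.filter fun i => (ω * ω') i = -1 with hB
  have hcard : Bᶜ.card + B.card = n := by
    rw [add_comm, Finset.card_add_card_compl]; simp
  have hpair := map_signed_sum_pair ω Bᶜ B disjoint_compl_left
  have hg := gaussian_prod_abs_lt hn hcard
  rw [← hpair, Measure.map_apply (by fun_prop)
    (measurableSet_lt (by fun_prop) (by fun_prop))] at hg
  unfold frac
  rw [← hB, ← hg]
  apply measure_congr
  filter_upwards [dot_ne_zero_ae hn ω, dot_ne_zero_ae hn ω'] with g h1 h2
  have e1 : dot ω g = ∑ i ∈ Bᶜ, g i * toReal (ω i) + ∑ i ∈ B, g i * toReal (ω i) := by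
    rw [add_comm, Finset.sum_add_sum_compl]; rfl
  have e2 : dot ω' g = ∑ i ∈ Bᶜ, g i * toReal (ω i) - ∑ i ∈ B, g i * toReal (ω i) := by
    unfold dot
    rw [← Finset.sum_add_sum_compl B, add_comm, sub_eq_add_neg, ← Finset.sum_neg_distrib]
    congr 1
    · refine Finset.sum_congr rfl fun i hi => ?_
      have hi' : ω i * ω' i ≠ -1 := by simpa [hB] using hi
      have : ω' i = ω i := by
        rcases Int.units_eq_one_or (ω i) with h | h <;>
          rcases Int.units_eq_one_or (ω' i) with h' | h' <;> simp_all
      rw [this]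
    · refine Finset.sum_congr rfl fun i hi => ?_
      have hi' : ω i * ω' i = -1 := by simpa [hB] using hi
      have : ω' i = - ω i := by
        rcases Int.units_eq_one_or (ω i) with h | h <;>
          rcases Int.units_eq_one_or (ω' i) with h' | h' <;> simp_all
      rw [this, toReal_neg]; ring
  apply propext
  change sgn (dot ω g) ≠ sgn (dot ω' g) ↔
    |∑ i ∈ Bᶜ, g i * toReal (ω i)| < |∑ i ∈ B, g i * toReal (ω i)|
  rw [e1] at h1 ⊢
  rw [e2] at h2 ⊢
  generalize ∑ i ∈ Bᶜ, g i * toReal (ω i) = a at *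
  generalize ∑ i ∈ B, g i * toReal (ω i) = b at *
  rw [← sq_lt_sq]
  have h11 : (1 : ℤˣ) ≠ -1 := by decide
  unfold sgn
  rcases lt_or_gt_of_ne h1 with h | h <;> rcases lt_or_gt_of_ne h2 with h' | h'
  · rw [if_neg (by linarith), if_neg (by linarith)]
    simp only [ne_eq, not_true_eq_false, false_iff, not_lt]; nlinarith
  · rw [if_neg (by linarith), if_pos (by linarith)]
    simp only [ne_eq, h11.symm, not_false_eq_true, true_iff]; nlinarith
  · rw [if_pos (by linarith), if_neg (by linarith)]
    simp only [ne_eq, h11, not_false_eq_true, true_iff]; nlinarith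
  · rw [if_pos (by linarith), if_pos (by linarith)]
    simp only [ne_eq, not_true_eq_false, false_iff, not_lt]; nlinarith

theorem rowLaw_map_neg (n : ℕ) : (rowLaw n).map (fun g i => -g i) = rowLaw n := by
  unfold rowLaw
  rw [Measure.pi_map_pi (f := fun _ (x : ℝ) => -x) (fun i => by fun_prop)]
  simp [gaussianReal_map_neg]

theorem flipLaw_singleton_one (p : ℝ) : flipLaw p {1} = ENNReal.ofReal (1 - p) := by
  have : (-1 : ℤˣ) ∉ ({1} : Set ℤˣ) := by simp
  simp [flipLaw, this]

theorem flipLaw_singleton_neg_one (p : ℝ) : flipLaw p {-1} = ENNReal.ofReal p := by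
  have : (1 : ℤˣ) ∉ ({-1} : Set ℤˣ) := by simp
  simp [flipLaw, this]

theorem isProbabilityMeasure_flipLaw {p : ℝ} (hp : p ∈ Set.Icc (0 : ℝ) 1) :
    IsProbabilityMeasure (flipLaw p) := ⟨by
  have h0 := hp.1
  have h1 := hp.2
  simp only [flipLaw, Measure.add_apply, Measure.smul_apply, measure_univ, smul_eq_mul, mul_one]
  rw [← ENNReal.ofReal_add (by linarith) h0]
  simp⟩

/-- The law of the signs of one node on two inputs. -/
theorem rowLaw_map_sgn_pair {n : ℕ} (hn : 0 < n) (ω ω' : Cube n) :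
    (rowLaw n).map (fun g => (sgn (dot ω g), sgn (dot ω' g))) =
      ((flipLaw (1 / 2)).prod (flipLaw (phi (frac (ω * ω'))))).map fun p => (p.1, p.1 * p.2) := by
  set p := phi (frac (ω * ω')) with hp
  have hp0 : 0 ≤ p := phi_nonneg _
  have hp1 : p ≤ 1 := phi_le_one _
  have hmeas : Measurable fun g => (sgn (dot ω g), sgn (dot ω' g)) :=
    (measurable_sgn.comp (measurable_dot ω)).prodMk (measurable_sgn.comp (measurable_dot ω'))
  set μ := (rowLaw n).map (fun g => (sgn (dot ω g), sgn (dot ω' g))) with hμ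
  have : IsProbabilityMeasure μ := Measure.isProbabilityMeasure_map hmeas.aemeasurable
  -- Negating the weights equates antipodal sign pairs, so the separation probability alone
  -- determines all four masses.
  have hsymm : ∀ u v : ℤˣ, μ {(u, v)} = μ {(-u, -v)} := by
    intro u v
    rw [hμ, Measure.map_apply hmeas (measurableSet_singleton _),
      Measure.map_apply hmeas (measurableSet_singleton _)]
    conv_rhs => rw [← rowLaw_map_neg n]
    rw [Measure.map_apply (by fun_prop) (hmeas (measurableSet_singleton _))]
    apply measure_congr
    filter_upwards [dot_ne_zero_ae hn ω, dot_ne_zero_ae hn ω'] with g h1 h2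
    apply propext
    have e : ∀ ω : Cube n, dot ω (fun i => -g i) = -dot ω g := by
      intro ω; simp [dot]
    change (sgn (dot ω g), sgn (dot ω' g)) = (u, v) ↔
      (sgn (dot ω fun i => -g i), sgn (dot ω' fun i => -g i)) = (-u, -v)
    rw [e, e, sgn_neg h1, sgn_neg h2]
    simp
  have hne : μ {(1, -1)} + μ {(-1, 1)} = ENNReal.ofReal p := by
    rw [← rowLaw_sgn_ne hn ω ω', ← measure_union (by simp) (measurableSet_singleton _), hμ,
      Measure.map_apply hmeas (Set.toFinite _).measurableSet]
    congr 1
    ext g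
    simp only [Set.mem_preimage, Set.mem_union, Set.mem_singleton_iff, Prod.mk.injEq,
      Set.mem_ofPred_eq]
    rcases Int.units_eq_one_or (sgn (dot ω g)) with h | h <;>
      rcases Int.units_eq_one_or (sgn (dot ω' g)) with h' | h' <;> simp [h, h']
  have heq : μ {(1, 1)} + μ {(-1, -1)} = ENNReal.ofReal (1 - p) := by
    have hc : ({(1, 1)} ∪ {(-1, -1)} : Set (ℤˣ × ℤˣ)) = ({(1, -1)} ∪ {(-1, 1)})ᶜ := by
      ext ⟨u, v⟩
      rcases Int.units_eq_one_or u with rfl | rfl <;>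
        rcases Int.units_eq_one_or v with rfl | rfl <;> simp
    rw [← measure_union (by simp) (measurableSet_singleton _), hc,
      measure_compl (Set.toFinite _).measurableSet (measure_ne_top _ _), measure_univ,
      measure_union (by simp) (measurableSet_singleton _), hne,
      ENNReal.ofReal_sub _ hp0, ENNReal.ofReal_one]
  rw [← hsymm 1 1] at heq
  have hs2 := hsymm 1 (-1)
  rw [neg_neg] at hs2
  rw [← hs2] at hne
  have half : ∀ (a : ENNReal) (x : ℝ), 0 ≤ x → a + a = ENNReal.ofReal x →
      a = ENNReal.ofReal (1 / 2 * x) := by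
    intro a x hx h
    rw [← two_mul] at h
    have h2 : ENNReal.ofReal x = 2 * ENNReal.ofReal (1 / 2 * x) := by
      rw [show (2 : ENNReal) = ENNReal.ofReal 2 by simp, ← ENNReal.ofReal_mul (by norm_num)]
      congr 1; ring
    rw [h2] at h
    exact (ENNReal.mul_right_inj (by simp) (by simp)).1 h
  have a1 := half _ _ (by linarith) heq
  have a2 := half _ _ hp0 hne
  have hpre : ∀ u v : ℤˣ, (fun q : ℤˣ × ℤˣ => (q.1, q.1 * q.2)) ⁻¹' {(u, v)} = {u} ×ˢ {u * v} := by
    intro u v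
    ext ⟨a, b⟩
    simp only [Set.mem_preimage, Set.mem_singleton_iff, Prod.mk.injEq, Set.mem_prod]
    refine and_congr_right fun h => ?_
    rw [h, ← mul_right_inj u (b := u * b), ← mul_assoc, Int.units_mul_self, one_mul]
  refine Measure.ext_of_singleton fun ⟨u, v⟩ => ?_
  rw [Measure.map_apply (μ := (flipLaw (1 / 2)).prod _) (measurable_of_countable _)
    (measurableSet_singleton _), hpre, Measure.prod_prod]
  have hhalf : flipLaw (1 / 2) {u} = ENNReal.ofReal (1 / 2) := by
    rcases Int.units_eq_one_or u with rfl | rfl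
    · rw [flipLaw_singleton_one]; norm_num
    · rw [flipLaw_singleton_neg_one]
  rw [hhalf]
  have hpm : (0 : ℝ) ≤ 1 / 2 := by norm_num
  rcases Int.units_eq_one_or u with rfl | rfl <;> rcases Int.units_eq_one_or v with rfl | rfl
  · rw [a1, one_mul, flipLaw_singleton_one, ENNReal.ofReal_mul hpm]
  · rw [a2, one_mul, flipLaw_singleton_neg_one, ENNReal.ofReal_mul hpm]
  · rw [← hs2, a2, mul_one, flipLaw_singleton_neg_one, ENNReal.ofReal_mul hpm]
  · rw [← hsymm 1 1, a1, neg_mul_neg, one_mul, flipLaw_singleton_one, ENNReal.ofReal_mul hpm]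

/-- One layer maps a pair of inputs to a uniform input together with a noisy copy. -/
theorem matrixLaw_map_layer_pair {n : ℕ} (ω ω' : Cube n) :
    (matrixLaw n).map (fun θ => (layer θ ω, layer θ ω')) = noisePair n (phi (frac (ω * ω'))) := by
  set p := phi (frac (ω * ω')) with hp
  have hI : p ∈ Set.Icc (0 : ℝ) 1 := ⟨phi_nonneg _, phi_le_one _⟩
  have hprob := isProbabilityMeasure_flipLaw hI
  have hprob2 := isProbabilityMeasure_flipLaw (p := 1 / 2) (by norm_num)
  have hl : ∀ ω : Cube n, Measurable fun θ : Weights n => layer θ ω := fun ω =>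
    measurable_pi_lambda _ fun i => measurable_sgn.comp (by fun_prop)
  -- In width `0` the preactivation is identically `0` and the row law is degenerate, but the cube
  -- is a single point.
  rcases Nat.eq_zero_or_pos n with rfl | hn
  · have : IsProbabilityMeasure (matrixLaw 0) := by unfold matrixLaw; infer_instance
    have h1 : IsProbabilityMeasure
        ((matrixLaw 0).map (fun θ => (layer θ ω, layer θ ω'))) :=
      Measure.isProbabilityMeasure_map ((hl ω).prodMk (hl ω')).aemeasurable
    have h2 : IsProbabilityMeasure (noisePair 0 p) :=
      Measure.isProbabilityMeasure_map (measurable_of_countable _).aemeasurable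
    refine Measure.ext_of_singleton fun q => ?_
    have hq : ({q} : Set (Cube 0 × Cube 0)) = Set.univ := Set.eq_univ_of_forall fun x =>
      Subsingleton.elim _ _
    rw [hq, measure_univ, measure_univ]
  · have hrow := Measure.pi_map_pi (μ := fun _ : Fin n => rowLaw n)
      (f := fun _ g => (sgn (dot ω g), sgn (dot ω' g)))
      (fun _ => ((measurable_sgn.comp (measurable_dot ω)).prodMk
        (measurable_sgn.comp (measurable_dot ω'))).aemeasurable)
    simp only [rowLaw_map_sgn_pair hn ω ω', ← hp] at hrow
    have hprob3 : IsProbabilityMeasure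
        (((flipLaw (1 / 2)).prod (flipLaw p)).map fun q => (q.1, q.1 * q.2)) :=
      Measure.isProbabilityMeasure_map (measurable_of_countable _).aemeasurable
    have hsf : ∀ ν : Measure (ℤˣ × ℤˣ), IsProbabilityMeasure ν → SigmaFinite ν :=
      fun ν _ => inferInstance
    have hflip := Measure.pi_map_pi (μ := fun _ : Fin n => (flipLaw (1 / 2)).prod (flipLaw p))
      (hμ := fun _ => hsf _ hprob3)
      (f := fun _ (q : ℤˣ × ℤˣ) => (q.1, q.1 * q.2))
      (fun _ => (measurable_of_countable _).aemeasurable)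
    rw [← hflip] at hrow
    have hsw := (measurePreserving_arrowProdEquivProdArrow ℤˣ ℤˣ (Fin n)
      (fun _ => flipLaw (1 / 2)) (fun _ => flipLaw p)).map_eq
    have hfin := congrArg (Measure.map
      (MeasurableEquiv.arrowProdEquivProdArrow ℤˣ ℤˣ (Fin n))) hrow
    have hm : Measurable fun (θ : Fin n → Fin n → ℝ) (i : Fin n) =>
        (sgn (dot ω (θ i)), sgn (dot ω' (θ i))) :=
      measurable_pi_lambda _ fun i => ((measurable_sgn.comp (measurable_dot ω)).prodMk
        (measurable_sgn.comp (measurable_dot ω'))).comp (measurable_pi_apply i)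
    rw [Measure.map_map (MeasurableEquiv.measurable _) hm,
      Measure.map_map (MeasurableEquiv.measurable _) (measurable_of_countable _)] at hfin
    unfold noisePair
    rw [← hsw, Measure.map_map (measurable_of_countable _) (MeasurableEquiv.measurable _)]
    exact hfin

/-! ### The distance chain -/

/-- The law of `n` independent signs, each `-1` with probability `p`. -/
def flips (n : ℕ) (p : ℝ) : Measure (Cube n) := Measure.pi fun _ => flipLaw p

theorem isProbabilityMeasure_flips (n : ℕ) {p : ℝ} (hp : p ∈ Set.Icc (0 : ℝ) 1) :
    IsProbabilityMeasure (flips n p) := by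
  have := isProbabilityMeasure_flipLaw hp
  unfold flips; infer_instance

theorem half_mem_Icc : (1 / 2 : ℝ) ∈ Set.Icc (0 : ℝ) 1 := by norm_num

theorem phi_mem_Icc (x : ℝ) : phi x ∈ Set.Icc (0 : ℝ) 1 := ⟨phi_nonneg x, phi_le_one x⟩

instance (n : ℕ) : IsProbabilityMeasure (flips n (1 / 2)) :=
  isProbabilityMeasure_flips n half_mem_Icc

instance (n : ℕ) (x : ℝ) : IsProbabilityMeasure (flips n (phi x)) :=
  isProbabilityMeasure_flips n (phi_mem_Icc x)

theorem isProbabilityMeasure_noisePair (n : ℕ) {p : ℝ} (hp : p ∈ Set.Icc (0 : ℝ) 1) :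
    IsProbabilityMeasure (noisePair n p) := by
  have := isProbabilityMeasure_flipLaw hp
  have := isProbabilityMeasure_flipLaw half_mem_Icc
  exact Measure.isProbabilityMeasure_map (measurable_of_countable _).aemeasurable

/-- The average of `G` over pairs of points whose quotient is `D`. -/
def pairAvg {n : ℕ} (G : Cube n × Cube n → ℝ) (D : Cube n) : ℝ :=
  ∫ u, G (u, u * D) ∂flips n (1 / 2)

theorem integral_noisePair {n : ℕ} {p : ℝ} (hp : p ∈ Set.Icc (0 : ℝ) 1)
    (G : Cube n × Cube n → ℝ) :
    ∫ q, G q ∂noisePair n p = ∫ D, pairAvg G D ∂flips n p := by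
  have := isProbabilityMeasure_flips n hp
  have h : noisePair n p = ((flips n (1 / 2)).prod (flips n p)).map fun p => (p.1, p.1 * p.2) := rfl
  rw [h, integral_map (measurable_of_countable _).aemeasurable
    (measurable_of_countable _).aestronglyMeasurable, integral_prod_symm _ (Integrable.of_finite)]
  rfl

/-- The transition operator of the quotient of two inputs under a layer. -/
def chainStep {n : ℕ} (g : Cube n → ℝ) (D : Cube n) : ℝ := ∫ E, g E ∂flips n (phi (frac D))

/-- The expectation of `g` after `t` steps of the chain started from `flips n p`. -/
def chainExp {n : ℕ} (p : ℝ) (t : ℕ) (g : Cube n → ℝ) : ℝ :=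
  ∫ D, (chainStep^[t] g) D ∂flips n p

/-- The transition operator of a pair of inputs under a layer. -/
def pairStep {n : ℕ} (G : Cube n × Cube n → ℝ) (q : Cube n × Cube n) : ℝ :=
  ∫ r, G r ∂noisePair n (phi (frac (q.1 * q.2)))

theorem cube_mul_self {n : ℕ} (u : Cube n) : u * u = 1 := by
  ext i; simp

/-- The pair transition depends on the pair only through its quotient, so averaging over the first
point intertwines it with the quotient chain. -/
theorem pairAvg_pairStep {n : ℕ} (G : Cube n × Cube n → ℝ) :
    pairAvg (pairStep G) = chainStep (pairAvg G) := by
  ext D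
  simp only [pairAvg, pairStep, chainStep, ← mul_assoc, cube_mul_self, one_mul]
  rw [integral_noisePair (phi_mem_Icc _), integral_const, probReal_univ, one_smul]
  rfl

theorem pairAvg_iterate {n : ℕ} (T : ℕ) (G : Cube n × Cube n → ℝ) :
    pairAvg (pairStep^[T] G) = chainStep^[T] (pairAvg G) := by
  induction T generalizing G with
  | zero => rfl
  | succ T ih => rw [Function.iterate_succ_apply, ih, pairAvg_pairStep, Function.iterate_succ_apply]

instance (n : ℕ) : IsProbabilityMeasure (matrixLaw n) := by unfold matrixLaw; infer_instance

instance (n T : ℕ) : IsProbabilityMeasure (weightLaw n T) := by unfold weightLaw; infer_instance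

theorem integrable_comp_of_finite {Ω α : Type*} [MeasurableSpace Ω] [MeasurableSpace α] [Finite α]
    [MeasurableSingletonClass α] {μ : Measure Ω} [IsFiniteMeasure μ] {X : Ω → α}
    (hX : Measurable X) (G : α → ℝ) : Integrable (fun x => G (X x)) μ :=
  Integrable.comp_measurable (g := G) Integrable.of_finite hX

theorem measurable_layer {n : ℕ} (ω : Cube n) : Measurable fun θ : Weights n => layer θ ω :=
  measurable_pi_lambda _ fun i => measurable_sgn.comp (by fun_prop)

theorem integral_layer {n : ℕ} (G : Cube n × Cube n → ℝ) (q : Cube n × Cube n) :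
    ∫ θ, G (layer θ q.1, layer θ q.2) ∂matrixLaw n = pairStep G q := by
  rw [pairStep, ← matrixLaw_map_layer_pair, integral_map
    ((measurable_layer _).prodMk (measurable_layer _)).aemeasurable
    (measurable_of_countable _).aestronglyMeasurable]

/-- The last layer is independent of the state it acts on, so integrating it out first replaces `G`
by `pairStep G`. -/
theorem integral_state {n : ℕ} (T : ℕ) (G : Cube n × Cube n → ℝ) (q : Cube n × Cube n) :
    ∫ θ, G (state T θ q.1, state T θ q.2) ∂weightLaw n T = (pairStep^[T] G) q := by
  induction T generalizing G with
  | zero => simp [state]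
  | succ T ih =>
    have hmp := measurePreserving_piFinSuccAbove (fun _ : Fin (T + 1) => matrixLaw n) (Fin.last T)
    have hm : ∀ ω : Cube n, Measurable fun z : Weights n × (Fin T → Weights n) =>
        layer z.1 (state T z.2 ω) := by
      intro ω
      have : Measurable fun z : Weights n × Cube n => layer z.1 z.2 :=
        measurable_from_prod_countable_left fun ω' => measurable_layer ω'
      exact this.comp (measurable_fst.prodMk ((measurable_state T ω).comp measurable_snd))
    have hint := integrable_comp_of_finite (μ := (matrixLaw n).prod (weightLaw n T))
      ((hm q.1).prodMk (hm q.2)) G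
    have h1 : ∫ θ, G (state (T + 1) θ q.1, state (T + 1) θ q.2) ∂weightLaw n (T + 1) =
        ∫ z, G (layer z.1 (state T z.2 q.1), layer z.1 (state T z.2 q.2))
          ∂(matrixLaw n).prod (weightLaw n T) := by
      refine Eq.trans ?_ (hmp.integral_comp (MeasurableEquiv.measurableEmbedding _)
        (fun z : Weights n × (Fin T → Weights n) =>
          G (layer z.1 (state T z.2 q.1), layer z.1 (state T z.2 q.2))))
      refine integral_congr_ae (Eventually.of_forall fun θ => ?_)
      simp only [state, MeasurableEquiv.piFinSuccAbove_apply, Fin.insertNthEquiv,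
        Equiv.coe_fn_symm_mk]
      have hr : (Fin.last T).removeNth θ = fun t => θ t.castSucc := by
        funext t; simp only [Fin.removeNth, Fin.succAbove_last]
      rw [hr]
    rw [h1, integral_prod_symm _ hint, Function.iterate_succ_apply, ← ih]
    refine integral_congr_ae (Eventually.of_forall fun θ => ?_)
    exact integral_layer G (state T θ q.1, state T θ q.2)

theorem integral_swap_of_finite {Ω α : Type*} [MeasurableSpace Ω] [MeasurableSpace α] [Finite α]
    [MeasurableSingletonClass α] {μ : Measure Ω} {ν : Measure α} [IsFiniteMeasure ν]
    (F : Ω → α → ℝ) (hF : ∀ a, Integrable (fun x => F x a) μ) :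
    ∫ x, ∫ a, F x a ∂ν ∂μ = ∫ a, ∫ x, F x a ∂μ ∂ν := by
  have := Fintype.ofFinite α
  simp only [integral_fintype Integrable.of_finite, smul_eq_mul]
  rw [integral_finsetSum _ fun a _ => (hF a).const_mul _]
  simp only [integral_const_mul]

/-- Joint expectations over the network and a noisy pair of inputs. -/
theorem integral_netLaw_prod {n : ℕ} (T : ℕ) (h : BoolFun n) {p : ℝ} (hp : p ∈ Set.Icc (0 : ℝ) 1)
    (G : ℤˣ × ℤˣ → ℝ) :
    ∫ f, ∫ q, G (f q.1, f q.2) ∂noisePair n p ∂netLaw T h =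
      chainExp p T (pairAvg fun q => G (h q.1, h q.2)) := by
  have := isProbabilityMeasure_noisePair n hp
  rw [netLaw, integral_map (measurable_netFun T h).aemeasurable
    (measurable_of_countable _).aestronglyMeasurable, integral_swap_of_finite]
  · simp only [netFun]
    have h1 := fun q => integral_state T (fun q : Cube n × Cube n => G (h q.1, h q.2)) q
    simp only at h1
    simp only [h1]
    rw [integral_noisePair hp, pairAvg_iterate]
    rfl
  · intro q
    exact integrable_comp_of_finite ((measurable_state T q.1).prodMk (measurable_state T q.2))
      (fun r : Cube n × Cube n => G (h r.1, h r.2))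

instance {n : ℕ} (T : ℕ) (h : BoolFun n) : IsProbabilityMeasure (netLaw T h) :=
  Measure.isProbabilityMeasure_map (measurable_netFun T h).aemeasurable

/-! ### Fourier analysis on the cube -/

theorem integral_flipLaw {p : ℝ} (hp : p ∈ Set.Icc (0 : ℝ) 1) (g : ℤˣ → ℝ) :
    ∫ u, g u ∂flipLaw p = (1 - p) * g 1 + p * g (-1) := by
  have h0 := hp.1
  have h1 := hp.2
  have := isProbabilityMeasure_flipLaw hp
  rw [flipLaw, integral_add_measure, integral_smul_measure, integral_smul_measure,
    integral_dirac, integral_dirac, ENNReal.toReal_ofReal (by linarith), ENNReal.toReal_ofReal h0]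
  · rfl
  · exact (Integrable.of_finite).smul_measure (by simp)
  · exact (Integrable.of_finite).smul_measure (by simp)

theorem integral_prod_flips {n : ℕ} {p : ℝ} (hp : p ∈ Set.Icc (0 : ℝ) 1)
    (g : Fin n → ℤˣ → ℝ) :
    ∫ D, ∏ i, g i (D i) ∂flips n p = ∏ i, ((1 - p) * g i 1 + p * g i (-1)) := by
  have := isProbabilityMeasure_flipLaw hp
  rw [flips, integral_fintype_prod_eq_prod]
  simp only [integral_flipLaw hp]

theorem integral_uniform {n : ℕ} (g : Cube n → ℝ) :
    ∫ u, g u ∂flips n (1 / 2) = (2 ^ n : ℝ)⁻¹ * ∑ u, g u := by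
  have := isProbabilityMeasure_flipLaw half_mem_Icc
  rw [integral_fintype Integrable.of_finite, Finset.mul_sum]
  refine Finset.sum_congr rfl fun u _ => ?_
  have h1 : ∀ v : ℤˣ, flipLaw (1 / 2) {v} = ENNReal.ofReal (1 / 2) := by
    intro v
    rcases Int.units_eq_one_or v with rfl | rfl
    · rw [flipLaw_singleton_one]; norm_num
    · rw [flipLaw_singleton_neg_one]
  have : (flips n (1 / 2)).real {u} = (2 ^ n : ℝ)⁻¹ := by
    rw [Measure.real, flips, Measure.pi_singleton]
    simp only [h1]
    simp
  rw [this, smul_eq_mul]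

/-- Walsh characters. -/
def chi {n : ℕ} (S : Finset (Fin n)) (D : Cube n) : ℝ := ∏ i ∈ S, toReal (D i)

theorem chi_mul {n : ℕ} (S : Finset (Fin n)) (D E : Cube n) : chi S (D * E) = chi S D * chi S E := by
  simp [chi, toReal_mul, Finset.prod_mul_distrib]

theorem chi_one {n : ℕ} (S : Finset (Fin n)) : chi S 1 = 1 := by
  simp [chi, toReal_one]

theorem integral_chi {n : ℕ} {p : ℝ} (hp : p ∈ Set.Icc (0 : ℝ) 1) (S : Finset (Fin n)) :
    ∫ D, chi S D ∂flips n p = (1 - 2 * p) ^ S.card := by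
  classical
  have h := integral_prod_flips hp (fun i u => if i ∈ S then toReal u else 1)
  simp only [Finset.prod_ite_mem, Finset.univ_inter] at h
  have e : ∀ D : Cube n, chi S D = ∏ i ∈ S, toReal (D i) := fun D => rfl
  simp only [e, h]
  rw [← Finset.prod_const, ← Finset.prod_subset (Finset.subset_univ S)]
  · refine Finset.prod_congr rfl fun i hi => ?_
    simp only [hi, if_true, toReal_one, toReal_neg_one]; ring
  · intro i _ hi
    simp [hi]

theorem sum_chi_mul_chi {n : ℕ} (u v : Cube n) :
    ∑ S, chi S u * chi S v = if u = v then (2 ^ n : ℝ) else 0 := by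
  classical
  have h : ∑ S, chi S u * chi S v = ∏ i, (1 + toReal (u i * v i)) := by
    rw [Finset.prod_one_add, Finset.powerset_univ]
    refine Finset.sum_congr rfl fun S _ => ?_
    simp [chi, toReal_mul, Finset.prod_mul_distrib]
  rw [h]
  split_ifs with huv
  · subst huv
    simp only [toReal_mul, toReal_mul_self]
    norm_num
  · obtain ⟨i, hi⟩ := Function.ne_iff.1 huv
    refine Finset.prod_eq_zero (Finset.mem_univ i) ?_
    have : u i * v i = -1 := by
      rcases Int.units_eq_one_or (u i) with h | h <;>
        rcases Int.units_eq_one_or (v i) with h' | h' <;> simp_all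
    rw [this, toReal_neg_one]; ring

/-- The Walsh coefficients of a Boolean function. -/
def walsh {n : ℕ} (f : BoolFun n) (S : Finset (Fin n)) : ℝ :=
  (2 ^ n : ℝ)⁻¹ * ∑ u, toReal (f u) * chi S u

/-- The autocorrelation of a Boolean function. -/
def corr {n : ℕ} (f : BoolFun n) : Cube n → ℝ :=
  pairAvg fun q => toReal (f q.1) * toReal (f q.2)

/-- Only `f (u * D)` is expanded in characters; `chi S D` factors out and averaging over `u`
supplies the second copy of the coefficient. -/
theorem corr_eq_sum_walsh {n : ℕ} (f : BoolFun n) (D : Cube n) :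
    corr f D = ∑ S, walsh f S ^ 2 * chi S D := by
  classical
  have h2 : (2 ^ n : ℝ) ≠ 0 := by positivity
  have hpt : ∀ u, toReal (f (u * D)) =
      (2 ^ n : ℝ)⁻¹ * ∑ S, chi S u * chi S D * ∑ v, toReal (f v) * chi S v := by
    intro u
    simp only [Finset.mul_sum]
    rw [Finset.sum_comm]
    have : ∀ v, ∑ S, (2 ^ n : ℝ)⁻¹ * (chi S u * chi S D * (toReal (f v) * chi S v)) =
        if u * D = v then toReal (f v) else 0 := by
      intro v
      have := sum_chi_mul_chi (u * D) v
      calc _ = (2 ^ n : ℝ)⁻¹ * toReal (f v) * ∑ S, chi S (u * D) * chi S v := by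
            rw [Finset.mul_sum]
            refine Finset.sum_congr rfl fun S _ => ?_
            rw [chi_mul]; ring
        _ = _ := by
            rw [this]; split_ifs
            · field_simp
            · ring
    simp [this]
  unfold corr pairAvg
  rw [integral_uniform]
  simp only [hpt, walsh, Finset.mul_sum]
  rw [Finset.sum_comm]
  refine Finset.sum_congr rfl fun S _ => ?_
  rw [sq, Finset.sum_mul, Finset.sum_mul]
  refine Finset.sum_congr rfl fun u _ => ?_
  simp only [Finset.mul_sum, Finset.sum_mul]
  refine Finset.sum_congr rfl fun v _ => ?_
  ring

theorem integral_corr {n : ℕ} {p : ℝ} (hp : p ∈ Set.Icc (0 : ℝ) 1) (f : BoolFun n) :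
    ∫ D, corr f D ∂flips n p = ∑ S, walsh f S ^ 2 * (1 - 2 * p) ^ S.card := by
  have := isProbabilityMeasure_flips n hp
  simp only [corr_eq_sum_walsh]
  rw [integral_finsetSum _ fun _ _ => Integrable.of_finite]
  simp only [integral_const_mul, integral_chi hp]

theorem corr_one {n : ℕ} (f : BoolFun n) : corr f 1 = 1 := by
  simp only [corr, pairAvg, mul_one, toReal_mul_self, integral_const, probReal_univ, one_smul]

theorem sum_walsh_sq {n : ℕ} (f : BoolFun n) : ∑ S, walsh f S ^ 2 = 1 := by
  have := corr_eq_sum_walsh f 1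
  simpa [chi_one, corr_one] using this.symm

/-- The mean of a Boolean function under the uniform measure. -/
def cubeMean {n : ℕ} (f : BoolFun n) : ℝ := ∫ u, toReal (f u) ∂flips n (1 / 2)

theorem cubeMean_eq_walsh {n : ℕ} (f : BoolFun n) : cubeMean f = walsh f ∅ := by
  rw [cubeMean, integral_uniform]
  simp [walsh, chi]

theorem integral_corr_half {n : ℕ} (f : BoolFun n) :
    ∫ D, corr f D ∂flips n (1 / 2) = cubeMean f ^ 2 := by
  classical
  rw [integral_corr half_mem_Icc, Finset.sum_eq_single ∅]
  · simp [cubeMean_eq_walsh]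
  · intro S _ hS
    rw [show (1 - 2 * (1 / 2) : ℝ) = 0 by norm_num, zero_pow (by simpa using hS), mul_zero]
  · simp

theorem integral_corr_sub {n : ℕ} {p : ℝ} (hp : p ∈ Set.Icc (0 : ℝ) 1) (f : BoolFun n) :
    ∫ D, corr f D ∂flips n p - ∫ D, corr f D ∂flips n (1 / 2) =
      ∑ S ∈ Finset.univ.erase ∅, walsh f S ^ 2 * (1 - 2 * p) ^ S.card := by
  rw [integral_corr_half, integral_corr hp, ← Finset.add_sum_erase _ _ (Finset.mem_univ ∅),
    cubeMean_eq_walsh]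
  simp

/-- Every nonconstant character carries at least one factor `1 - 2p`, and the squared coefficients
sum to `1`. -/
theorem abs_integral_corr_sub_le {n : ℕ} {p : ℝ} (hp : p ∈ Set.Icc (0 : ℝ) 1) (f : BoolFun n) :
    |∫ D, corr f D ∂flips n p - ∫ D, corr f D ∂flips n (1 / 2)| ≤ |1 - 2 * p| := by
  have h0 := hp.1
  have h1 := hp.2
  rw [integral_corr_sub hp]
  have hle : |1 - 2 * p| ≤ 1 := abs_le.2 ⟨by linarith, by linarith⟩
  calc _ ≤ ∑ S ∈ Finset.univ.erase (∅ : Finset (Fin n)), walsh f S ^ 2 * |1 - 2 * p| := by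
        refine (Finset.abs_sum_le_sum_abs _ _).trans (Finset.sum_le_sum fun S hS => ?_)
        rw [abs_mul, abs_of_nonneg (sq_nonneg (walsh f S)), abs_pow]
        refine mul_le_mul_of_nonneg_left ?_ (sq_nonneg _)
        refine pow_le_of_le_one (abs_nonneg _) hle ?_
        simpa using hS
    _ ≤ ∑ S, walsh f S ^ 2 * |1 - 2 * p| :=
        Finset.sum_le_sum_of_subset_of_nonneg (Finset.erase_subset _ _) fun _ _ _ => by positivity
    _ = |1 - 2 * p| := by rw [← Finset.sum_mul, sum_walsh_sq, one_mul]

/-- Nonnegativity of quenched covariances is what later permits Markov's inequality. -/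
theorem integral_corr_sub_nonneg {n : ℕ} {p : ℝ} (h0 : 0 ≤ p) (h1 : p ≤ 1 / 2) (f : BoolFun n) :
    0 ≤ ∫ D, corr f D ∂flips n p - ∫ D, corr f D ∂flips n (1 / 2) := by
  rw [integral_corr_sub ⟨h0, by linarith⟩]
  have : 0 ≤ 1 - 2 * p := by linarith
  positivity

/-! ### Covariances -/

theorem pairAvg_fst {n : ℕ} (f : BoolFun n) (D : Cube n) :
    pairAvg (fun q => toReal (f q.1)) D = cubeMean f := rfl

theorem pairAvg_snd {n : ℕ} (f : BoolFun n) (D : Cube n) :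
    pairAvg (fun q => toReal (f q.2)) D = cubeMean f := by
  rw [pairAvg, cubeMean, integral_uniform, integral_uniform]
  congr 1
  exact Equiv.sum_comp (Equiv.mulRight D) (fun u => toReal (f u))

theorem memLp_of_finite {α : Type*} [MeasurableSpace α] [Finite α] [MeasurableSingletonClass α]
    {μ : Measure α} [IsFiniteMeasure μ] (g : α → ℝ) : MemLp g 2 μ := by
  obtain ⟨C, hC⟩ := (Set.toFinite (Set.range fun a => ‖g a‖)).bddAbove
  exact MemLp.of_bound (measurable_of_countable g).aestronglyMeasurable C
    (Eventually.of_forall fun a => hC ⟨a, rfl⟩)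

theorem noiseCov_eq {n : ℕ} {p : ℝ} (hp : p ∈ Set.Icc (0 : ℝ) 1) (f : BoolFun n) :
    noiseCov f p = ∫ D, corr f D ∂flips n p - ∫ D, corr f D ∂flips n (1 / 2) := by
  have := isProbabilityMeasure_noisePair n hp
  have := isProbabilityMeasure_flips n hp
  rw [noiseCov, covariance_eq_sub (memLp_of_finite _) (memLp_of_finite _), integral_corr_half]
  simp only [Pi.mul_apply]
  rw [integral_noisePair hp, integral_noisePair hp, integral_noisePair hp]
  simp only [pairAvg_fst, pairAvg_snd, integral_const, probReal_univ, one_smul, sq]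
  rfl

theorem chainStep_const {n : ℕ} (c : ℝ) : chainStep (fun _ : Cube n => c) = fun _ => c := by
  ext D; simp [chainStep]

theorem chainExp_const {n : ℕ} {p : ℝ} (hp : p ∈ Set.Icc (0 : ℝ) 1) (t : ℕ) (c : ℝ) :
    chainExp p t (fun _ : Cube n => c) = c := by
  have := isProbabilityMeasure_flips n hp
  rw [chainExp, Function.iterate_fixed (chainStep_const c)]
  simp

theorem annealedCov_eq {n : ℕ} {p : ℝ} (hp : p ∈ Set.Icc (0 : ℝ) 1) (T : ℕ) (h : BoolFun n) :
    annealedCov (netLaw T h) p = chainExp p T (corr h) - cubeMean h ^ 2 := by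
  have := isProbabilityMeasure_noisePair n hp
  rw [annealedCov, covariance_eq_sub (memLp_of_finite _) (memLp_of_finite _)]
  simp only [Pi.mul_apply]
  rw [integral_prod _ Integrable.of_finite, integral_prod _ Integrable.of_finite,
    integral_prod _ Integrable.of_finite]
  have h1 := integral_netLaw_prod T h hp (fun q => toReal q.1 * toReal q.2)
  have h2 := integral_netLaw_prod T h hp (fun q => toReal q.1)
  have h3 := integral_netLaw_prod T h hp (fun q => toReal q.2)
  simp only at h1 h2 h3
  rw [h1, h2, h3, funext (pairAvg_fst h), funext (pairAvg_snd h), chainExp_const hp, sq]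
  rfl

/-- The mean of the quenched covariance. -/
theorem integral_noiseCov_netLaw {n : ℕ} {p : ℝ} (hp : p ∈ Set.Icc (0 : ℝ) 1) (T : ℕ)
    (h : BoolFun n) :
    ∫ f, noiseCov f p ∂netLaw T h = chainExp p T (corr h) - chainExp (1 / 2) T (corr h) := by
  simp only [noiseCov_eq hp]
  rw [integral_sub Integrable.of_finite Integrable.of_finite]
  have h1 := integral_netLaw_prod T h hp (fun q => toReal q.1 * toReal q.2)
  have h2 := integral_netLaw_prod T h half_mem_Icc (fun q => toReal q.1 * toReal q.2)
  simp only [integral_noisePair hp] at h1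
  simp only [integral_noisePair half_mem_Icc] at h2
  exact congrArg₂ (· - ·) h1 h2

/-- The difference is a mean of quenched covariances and each function obeys the spectral bound.
Hence the estimate is uniform in depth and needs no mixing. -/
theorem abs_chainExp_corr_sub_le {n : ℕ} {p : ℝ} (hp : p ∈ Set.Icc (0 : ℝ) 1) (T : ℕ)
    (h : BoolFun n) :
    |chainExp p T (corr h) - chainExp (1 / 2) T (corr h)| ≤ |1 - 2 * p| := by
  rw [← integral_noiseCov_netLaw hp]
  refine (abs_integral_le_integral_abs).trans ?_
  calc _ ≤ ∫ f, |1 - 2 * p| ∂netLaw T h := by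
        refine integral_mono Integrable.of_finite Integrable.of_finite fun f => ?_
        simp only [noiseCov_eq hp]
        exact abs_integral_corr_sub_le hp f
    _ = _ := by simp

/-! ### The separation function -/

theorem phi_mono {x y : ℝ} (h : x ≤ y) : phi x ≤ phi y :=
  div_le_div_of_nonneg_right (Real.antitone_arccos (by linarith)) Real.pi_pos.le

theorem phi_one_sub (x : ℝ) : phi (1 - x) = 1 - phi x := by
  unfold phi
  rw [show 1 - 2 * (1 - x) = -(1 - 2 * x) by ring, Real.arccos_neg]
  field_simp

/-- From `sin t ≤ t`. The infinite slope at `0` drives the growth of small distances; the matching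
upper bound, from Jordan's inequality, serves stability. -/
theorem sqrt_le_phi {x : ℝ} (h0 : 0 ≤ x) (h1 : x ≤ 1) : 2 / Real.pi * √x ≤ phi x := by
  have hpi := Real.pi_pos
  rw [← sin_half_pi_mul_phi h0 h1]
  have hp := phi_nonneg x
  have := Real.sin_le (x := Real.pi * phi x / 2) (by positivity)
  calc _ ≤ 2 / Real.pi * (Real.pi * phi x / 2) := by gcongr
    _ = phi x := by field_simp

theorem phi_le_sqrt {x : ℝ} (h0 : 0 ≤ x) (h1 : x ≤ 1) : phi x ≤ √x := by
  have hpi := Real.pi_pos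
  rw [← sin_half_pi_mul_phi h0 h1]
  have hp := phi_nonneg x
  have hp1 := phi_le_one x
  have := Real.mul_le_sin (x := Real.pi * phi x / 2) (by positivity) (by nlinarith)
  calc phi x = 2 / Real.pi * (Real.pi * phi x / 2) := by field_simp
    _ ≤ _ := this

theorem one_sub_two_mul_phi (x : ℝ) : 1 - 2 * phi x = 2 / Real.pi * Real.arcsin (1 - 2 * x) := by
  have hpi := Real.pi_pos
  unfold phi
  rw [Real.arccos_eq_pi_div_two_sub_arcsin]
  field_simp
  ring

theorem arcsin_le_of_nonneg {y : ℝ} (h0 : 0 ≤ y) (h1 : y ≤ 1) : 2 / Real.pi * Real.arcsin y ≤ y := by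
  have := Real.mul_le_sin (x := Real.arcsin y) (Real.arcsin_nonneg.2 h0) (Real.arcsin_le_pi_div_two y)
  rwa [Real.sin_arcsin (by linarith) h1] at this

/-- The sine lies above its chord on `[0, π/3]`, which gives slope `4/(3√3) < 4/5`. The bound `43/50
= 1 - 2 * (7/100)` is the bias at the edge of the window and lies below `√3/2`. -/
theorem arcsin_le_of_le {y : ℝ} (h0 : 0 ≤ y) (h1 : y ≤ 43 / 50) :
    2 / Real.pi * Real.arcsin y ≤ 4 / 5 * y := by
  have hpi := Real.pi_pos
  have h3 : (1.73 : ℝ) ≤ √3 := Real.le_sqrt_of_sq_le (by norm_num)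
  set β := Real.arcsin y with hβ
  have hsin : Real.sin β = y := Real.sin_arcsin (by linarith) (by linarith)
  have hβ0 : 0 ≤ β := Real.arcsin_nonneg.2 h0
  have hβ1 : β ≤ Real.pi / 3 := by
    rw [hβ, Real.arcsin_le_iff_le_sin ⟨by linarith, by linarith⟩ ⟨by linarith, by linarith⟩,
      Real.sin_pi_div_three]
    linarith
  have hb1 : 0 ≤ 1 - β / (Real.pi / 3) := by
    rw [sub_nonneg, div_le_one (by positivity)]; exact hβ1
  have hb2 : 0 ≤ β / (Real.pi / 3) := by positivity
  have hm1 : (0 : ℝ) ∈ Set.Icc 0 Real.pi := ⟨le_rfl, hpi.le⟩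
  have hm2 : Real.pi / 3 ∈ Set.Icc 0 Real.pi := ⟨by positivity, by linarith⟩
  have hconc := (strictConcaveOn_sin_Icc.concaveOn).2 hm1 hm2 hb1 hb2 (by ring)
  rw [Real.sin_zero, Real.sin_pi_div_three] at hconc
  simp only [smul_eq_mul, mul_zero, zero_add] at hconc
  rw [div_mul_cancel₀ _ (by positivity), hsin] at hconc
  have : β / (Real.pi / 3) * (1.73 / 2) ≤ y := le_trans (by gcongr) hconc
  have e : β / (Real.pi / 3) * (1.73 / 2) = 2 / Real.pi * β * (5.19 / 4) := by field_simp; norm_num; ring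
  rw [e] at this
  have : 0 ≤ 2 / Real.pi * β := by positivity
  linarith

theorem abs_two_div_pi_arcsin_le {c d y : ℝ}
    (h : ∀ z : ℝ, 0 ≤ z → z ≤ d → 2 / Real.pi * Real.arcsin z ≤ c * z) (hy : |y| ≤ d) :
    |2 / Real.pi * Real.arcsin y| ≤ c * |y| := by
  have hpi := Real.pi_pos
  have h1 := h |y| (abs_nonneg _) hy
  rw [abs_mul, abs_of_pos (by positivity : 0 < 2 / Real.pi)]
  convert h1 using 2
  rcases le_total 0 y with h | h
  · rw [abs_of_nonneg h, abs_of_nonneg (Real.arcsin_nonneg.2 h)]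
  · rw [abs_of_nonpos h, Real.arcsin_neg, abs_of_nonpos (Real.arcsin_nonpos.2 h)]

theorem abs_one_sub_two_mul_phi_le {x : ℝ} (h0 : 0 ≤ x) (h1 : x ≤ 1) :
    |1 - 2 * phi x| ≤ |1 - 2 * x| := by
  rw [one_sub_two_mul_phi]
  have := abs_two_div_pi_arcsin_le (c := 1) (d := 1) (y := 1 - 2 * x)
    (fun z hz hz1 => by rw [one_mul]; exact arcsin_le_of_nonneg hz hz1)
    (abs_le.2 ⟨by linarith, by linarith⟩)
  linarith

theorem abs_one_sub_two_mul_phi_le_of_mid {x : ℝ} (h0 : 7 / 100 ≤ x) (h1 : x ≤ 93 / 100) :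
    |1 - 2 * phi x| ≤ 4 / 5 * |1 - 2 * x| := by
  rw [one_sub_two_mul_phi]
  exact abs_two_div_pi_arcsin_le (d := 43 / 50) (fun z hz hz1 => arcsin_le_of_le hz hz1)
    (abs_le.2 ⟨by linarith, by linarith⟩)

/-- One step moves the window edge `7/100` to at least `39/250`, more than twice as far; this gap
gives exponentially small escape probabilities. -/
theorem phi_ge_of_ge {x : ℝ} (h0 : 7 / 100 ≤ x) : 39 / 250 ≤ phi x := by
  have h := abs_one_sub_two_mul_phi_le_of_mid (x := 7 / 100) le_rfl (by norm_num)
  rw [abs_le, abs_of_nonneg (by norm_num)] at h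
  have := phi_mono h0
  linarith [h.2]

theorem phi_le_of_le {x : ℝ} (h0 : x ≤ 93 / 100) : phi x ≤ 211 / 250 := by
  have h := abs_one_sub_two_mul_phi_le_of_mid (x := 93 / 100) (by norm_num) le_rfl
  rw [abs_le, abs_of_nonpos (by norm_num)] at h
  have := phi_mono h0
  linarith [h.1]

/-! ### Linearity and monotonicity of the chain -/

theorem integrable_flips {n : ℕ} {p : ℝ} (hp : p ∈ Set.Icc (0 : ℝ) 1) (g : Cube n → ℝ) :
    Integrable g (flips n p) := by
  have := isProbabilityMeasure_flips n hp
  exact Integrable.of_finite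

theorem chainExp_succ {n : ℕ} (p : ℝ) (t : ℕ) (g : Cube n → ℝ) :
    chainExp p (t + 1) g = chainExp p t (chainStep g) := by
  rw [chainExp, Function.iterate_succ_apply, chainExp]

theorem chainExp_add_time {n : ℕ} (p : ℝ) (s t : ℕ) (g : Cube n → ℝ) :
    chainExp p (s + t) g = chainExp p s (chainStep^[t] g) := by
  rw [chainExp, Function.iterate_add_apply, chainExp]

theorem chainStep_mono {n : ℕ} {g g' : Cube n → ℝ} (h : ∀ D, g D ≤ g' D) (D : Cube n) :
    chainStep g D ≤ chainStep g' D :=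
  integral_mono Integrable.of_finite Integrable.of_finite h

theorem chainExp_mono {n : ℕ} {p : ℝ} (hp : p ∈ Set.Icc (0 : ℝ) 1) (t : ℕ) {g g' : Cube n → ℝ}
    (h : ∀ D, g D ≤ g' D) : chainExp p t g ≤ chainExp p t g' := by
  induction t generalizing g g' with
  | zero => exact integral_mono (integrable_flips hp _) (integrable_flips hp _) h
  | succ t ih => rw [chainExp_succ, chainExp_succ]; exact ih (chainStep_mono h)

theorem chainExp_add {n : ℕ} {p : ℝ} (hp : p ∈ Set.Icc (0 : ℝ) 1) (t : ℕ) (g g' : Cube n → ℝ) :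
    chainExp p t (fun D => g D + g' D) = chainExp p t g + chainExp p t g' := by
  induction t generalizing g g' with
  | zero => exact integral_add (integrable_flips hp _) (integrable_flips hp _)
  | succ t ih =>
    rw [chainExp_succ, chainExp_succ, chainExp_succ, ← ih]
    congr 1; ext D
    exact integral_add Integrable.of_finite Integrable.of_finite

theorem chainExp_const_mul {n : ℕ} (p : ℝ) (t : ℕ) (c : ℝ) (g : Cube n → ℝ) :
    chainExp p t (fun D => c * g D) = c * chainExp p t g := by
  induction t generalizing g with
  | zero => exact integral_const_mul _ _
  | succ t ih =>
    rw [chainExp_succ, chainExp_succ, ← ih]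
    congr 1; ext D
    exact integral_const_mul _ _

theorem abs_chainExp_le {n : ℕ} {p : ℝ} (hp : p ∈ Set.Icc (0 : ℝ) 1) (t : ℕ) (g : Cube n → ℝ) :
    |chainExp p t g| ≤ chainExp p t (fun D => |g D|) := by
  rw [abs_le]
  constructor
  · have h := chainExp_mono hp t (g := fun D => (-1) * |g D|) (g' := g)
      (fun D => by linarith [neg_abs_le (g D)])
    rw [chainExp_const_mul] at h
    linarith
  · exact chainExp_mono hp t fun D => le_abs_self _

/-! ### Moments of the fraction of minus signs -/

theorem sum_toReal_eq {n : ℕ} (hn : 0 < n) (D : Cube n) :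
    1 - 2 * frac D = (n : ℝ)⁻¹ * ∑ i, toReal (D i) := by
  have hn' : (n : ℝ) ≠ 0 := by exact_mod_cast hn.ne'
  have h : ∀ i, toReal (D i) = 1 - 2 * (if D i = -1 then 1 else 0) := by
    intro i
    rcases Int.units_eq_one_or (D i) with h | h <;> simp [h, toReal]
    norm_num
  simp only [h, Finset.sum_sub_distrib, ← Finset.mul_sum, Finset.sum_boole]
  unfold frac
  simp
  field_simp

theorem integral_toReal {n : ℕ} {p : ℝ} (hp : p ∈ Set.Icc (0 : ℝ) 1) (i : Fin n) :
    ∫ D : Cube n, toReal (D i) ∂flips n p = 1 - 2 * p := by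
  simpa [chi] using integral_chi hp {i}

theorem integral_toReal_mul {n : ℕ} {p : ℝ} (hp : p ∈ Set.Icc (0 : ℝ) 1) (i j : Fin n) :
    ∫ D : Cube n, toReal (D i) * toReal (D j) ∂flips n p =
      if i = j then 1 else (1 - 2 * p) ^ 2 := by
  have := isProbabilityMeasure_flips n hp
  split_ifs with h
  · subst h; simp [toReal_mul_self]
  · simpa [chi, Finset.prod_pair h, Finset.card_pair h] using integral_chi hp {i, j}

theorem integral_bias {n : ℕ} (hn : 0 < n) {p : ℝ} (hp : p ∈ Set.Icc (0 : ℝ) 1) :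
    ∫ D : Cube n, (1 - 2 * frac D) ∂flips n p = 1 - 2 * p := by
  have hn' : (n : ℝ) ≠ 0 := by exact_mod_cast hn.ne'
  simp only [sum_toReal_eq hn]
  rw [integral_const_mul, integral_finsetSum _ fun _ _ => integrable_flips hp _]
  simp only [integral_toReal hp]
  simp
  field_simp

theorem integral_bias_sq {n : ℕ} (hn : 0 < n) {p : ℝ} (hp : p ∈ Set.Icc (0 : ℝ) 1) :
    ∫ D : Cube n, (1 - 2 * frac D) ^ 2 ∂flips n p =
      (1 - 2 * p) ^ 2 + (1 - (1 - 2 * p) ^ 2) / n := by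
  have hn' : (n : ℝ) ≠ 0 := by exact_mod_cast hn.ne'
  simp only [sum_toReal_eq hn, mul_pow]
  rw [integral_const_mul]
  simp only [sq (∑ i, _), Finset.sum_mul_sum]
  rw [integral_finsetSum _ fun _ _ => integrable_flips hp _]
  have h : ∀ i : Fin n, ∫ D : Cube n, ∑ j, toReal (D i) * toReal (D j) ∂flips n p =
      n * (1 - 2 * p) ^ 2 + (1 - (1 - 2 * p) ^ 2) := by
    intro i
    rw [integral_finsetSum _ fun _ _ => integrable_flips hp _]
    simp only [integral_toReal_mul hp]
    have : ∀ j : Fin n, (if i = j then (1 : ℝ) else (1 - 2 * p) ^ 2) =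
        (1 - 2 * p) ^ 2 + if i = j then 1 - (1 - 2 * p) ^ 2 else 0 := by
      intro j; split_ifs <;> ring
    simp only [this, Finset.sum_add_distrib]
    simp
  simp only [h]
  simp
  field_simp

theorem integral_frac {n : ℕ} (hn : 0 < n) {p : ℝ} (hp : p ∈ Set.Icc (0 : ℝ) 1) :
    ∫ D : Cube n, frac D ∂flips n p = p := by
  have := isProbabilityMeasure_flips n hp
  have h := integral_bias hn hp
  rw [integral_sub (integrable_flips hp _) (integrable_flips hp _), integral_const_mul] at h
  simp at h
  linarith

theorem integral_frac_sub_sq {n : ℕ} (hn : 0 < n) {p : ℝ} (hp : p ∈ Set.Icc (0 : ℝ) 1) :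
    ∫ D : Cube n, (frac D - p) ^ 2 ∂flips n p = p * (1 - p) / n := by
  have := isProbabilityMeasure_flips n hp
  have e : ∀ D : Cube n, (frac D - p) ^ 2 = 1 / 4 * (1 - 2 * frac D) ^ 2 +
      (-(1 / 2) * (1 - 2 * p) * (1 - 2 * frac D) + 1 / 4 * (1 - 2 * p) ^ 2) := by
    intro D; ring
  simp only [e]
  rw [integral_add (integrable_flips hp _) (integrable_flips hp _),
    integral_add (integrable_flips hp _) (integrable_flips hp _), integral_const_mul,
    integral_const_mul, integral_bias hn hp, integral_bias_sq hn hp]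
  simp
  ring

/-! ### Symmetry under a global flip -/

theorem flipLaw_map_neg (p : ℝ) : (flipLaw p).map (fun u => -u) = flipLaw (1 - p) := by
  refine Measure.ext_of_singleton fun u => ?_
  rw [Measure.map_apply (measurable_of_countable _) (measurableSet_singleton _)]
  have : (fun v : ℤˣ => -v) ⁻¹' {u} = {-u} := by
    ext v; simp
  rw [this]
  rcases Int.units_eq_one_or u with rfl | rfl
  · rw [flipLaw_singleton_neg_one, flipLaw_singleton_one]; congr 1; ring
  · rw [neg_neg, flipLaw_singleton_neg_one, flipLaw_singleton_one]

theorem integral_flips_neg {n : ℕ} {p : ℝ} (hp : p ∈ Set.Icc (0 : ℝ) 1) (g : Cube n → ℝ) :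
    ∫ D, g (-D) ∂flips n p = ∫ D, g D ∂flips n (1 - p) := by
  have := isProbabilityMeasure_flipLaw hp
  have h2 : IsProbabilityMeasure (flipLaw (1 - p)) :=
    isProbabilityMeasure_flipLaw ⟨by linarith [hp.2], by linarith [hp.1]⟩
  have h := Measure.pi_map_pi (μ := fun _ : Fin n => flipLaw p) (f := fun _ (u : ℤˣ) => -u)
    (hμ := fun _ => by rw [flipLaw_map_neg]; infer_instance)
    (fun _ => (measurable_of_countable _).aemeasurable)
  simp only [flipLaw_map_neg] at h
  rw [flips, flips, ← h, integral_map (measurable_of_countable _).aemeasurable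
    (measurable_of_countable _).aestronglyMeasurable]
  rfl

theorem frac_neg {n : ℕ} (hn : 0 < n) (D : Cube n) : frac (-D) = 1 - frac D := by
  have h1 := sum_toReal_eq hn D
  have h2 := sum_toReal_eq hn (-D)
  simp only [Pi.neg_apply, toReal_neg, Finset.sum_neg_distrib] at h2
  linarith

theorem chainStep_neg {n : ℕ} (hn : 0 < n) (g : Cube n → ℝ) (D : Cube n) :
    chainStep g (-D) = chainStep (fun E => g (-E)) D := by
  rw [chainStep, chainStep, integral_flips_neg (phi_mem_Icc _), frac_neg hn, phi_one_sub]

theorem chainStep_iterate_neg {n : ℕ} (hn : 0 < n) {g : Cube n → ℝ} (hg : ∀ D, g (-D) = -g D)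
    (t : ℕ) (D : Cube n) : (chainStep^[t] g) (-D) = -(chainStep^[t] g) D := by
  induction t generalizing g with
  | zero => exact hg D
  | succ t ih =>
    rw [Function.iterate_succ_apply]
    refine ih fun E => ?_
    rw [chainStep_neg hn]
    simp only [hg, chainStep, integral_neg]

/-- The uniform law is invariant under a global flip, and the chain commutes with it because `phi (1
- x) = 1 - phi x`. -/
theorem chainExp_half_of_odd {n : ℕ} (hn : 0 < n) {g : Cube n → ℝ} (hg : ∀ D, g (-D) = -g D)
    (t : ℕ) : chainExp (1 / 2) t g = 0 := by
  have h := integral_flips_neg (n := n) half_mem_Icc (chainStep^[t] g)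
  simp only [chainStep_iterate_neg hn hg, integral_neg] at h
  rw [show (1 : ℝ) - 1 / 2 = 1 / 2 by norm_num] at h
  rw [chainExp]
  linarith

/-! ### Escape probabilities -/

/-- The indicator of a fraction of minus signs below `y`. -/
def low {n : ℕ} (y : ℝ) (D : Cube n) : ℝ := if frac D < y then 1 else 0

/-- Chebyshev's inequality: falling below `p/2` is a deviation of at least `p/2`. -/
theorem integral_low_le {n : ℕ} (hn : 0 < n) {p y : ℝ} (h0 : 0 < p) (h1 : p ≤ 1) (hy : y ≤ p / 2) :
    ∫ D : Cube n, low y D ∂flips n p ≤ 4 / (n * p) := by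
  have hn' : (0 : ℝ) < n := by exact_mod_cast hn
  have hp : p ∈ Set.Icc (0 : ℝ) 1 := ⟨h0.le, h1⟩
  calc _ ≤ ∫ D : Cube n, 4 / p ^ 2 * (frac D - p) ^ 2 ∂flips n p := by
        refine integral_mono (integrable_flips hp _) (integrable_flips hp _) fun D => ?_
        unfold low
        simp only
        split_ifs with h
        · rw [div_mul_eq_mul_div, le_div_iff₀ (by positivity)]
          nlinarith
        · positivity
    _ = 4 * (1 - p) / (n * p) := by
        rw [integral_const_mul, integral_frac_sub_sq hn hp]
        field_simp
    _ ≤ _ := by gcongr; linarith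

/-- A Chernoff bound with weight `51/50` per plus sign and `(51/50)^(-13)` per minus sign. As `7/100
< 1/14`, on the event there are at least `13` plus signs per minus sign and the product is at least
`1`; its mean per coordinate is below `99/100`. -/
theorem integral_low_exp_le {n : ℕ} (hn : 0 < n) {p : ℝ} (h0 : 39 / 250 ≤ p) (h1 : p ≤ 1) :
    ∫ D : Cube n, low (7 / 100) D ∂flips n p ≤ (99 / 100) ^ n := by
  classical
  have hn' : (0 : ℝ) < n := by exact_mod_cast hn
  have hp : p ∈ Set.Icc (0 : ℝ) 1 := ⟨by linarith, h1⟩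
  have hw := integral_prod_flips (n := n) hp
    (fun _ u => if u = -1 then ((51 / 50 : ℝ) ^ 13)⁻¹ else 51 / 50)
  calc _ ≤ ∫ D : Cube n, ∏ i, (if D i = -1 then ((51 / 50 : ℝ) ^ 13)⁻¹ else 51 / 50)
        ∂flips n p := by
        refine integral_mono (integrable_flips hp _) (integrable_flips hp _) fun D => ?_
        unfold low
        simp only
        split_ifs with h
        · rw [Finset.prod_ite, Finset.prod_const, Finset.prod_const]
          set k := (Finset.univ.filter fun i => D i = -1).card with hk
          have hc : (Finset.univ.filter fun i => ¬ D i = -1).card + k = n := by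
            rw [hk, add_comm, Finset.card_filter_add_card_filter_not]; simp
          have hk' : 13 * k ≤ (Finset.univ.filter fun i => ¬ D i = -1).card := by
            have : (k : ℝ) / n < 7 / 100 := h
            rw [div_lt_iff₀ hn'] at this
            have h2 : (14 * k : ℝ) ≤ n := by linarith
            have h3 : 14 * k ≤ n := by exact_mod_cast h2
            omega
          rw [inv_pow, ← pow_mul, inv_mul_eq_div, one_le_div (by positivity)]
          exact pow_le_pow_right₀ (by norm_num) hk'
        · exact Finset.prod_nonneg fun i _ => by split_ifs <;> positivity
    _ ≤ (99 / 100) ^ n := by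
        rw [hw, Finset.prod_const, Finset.card_univ, Fintype.card_fin]
        have h11 : (1 : ℤˣ) ≠ -1 := by decide
        rw [if_neg h11, if_pos rfl]
        have hb : ((51 / 50 : ℝ) ^ 13)⁻¹ ≤ 78 / 100 := by
          rw [inv_le_comm₀ (by positivity) (by norm_num)]; norm_num
        have hb0 : 0 ≤ ((51 / 50 : ℝ) ^ 13)⁻¹ := by positivity
        apply pow_le_pow_left₀
        · have : 0 ≤ 1 - p := by linarith
          have := hp.1
          positivity
        · nlinarith

/-- The indicator of a fraction of minus signs outside `[y, 93/100]`. -/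
def outside {n : ℕ} (y : ℝ) (D : Cube n) : ℝ := if frac D < y ∨ 93 / 100 < frac D then 1 else 0

theorem outside_le_one {n : ℕ} (y : ℝ) (D : Cube n) : outside y D ≤ 1 := by
  unfold outside; split_ifs <;> norm_num

theorem outside_nonneg {n : ℕ} (y : ℝ) (D : Cube n) : 0 ≤ outside y D := by
  unfold outside; split_ifs <;> norm_num

theorem outside_le_low_add {n : ℕ} (hn : 0 < n) (y : ℝ) (D : Cube n) :
    outside y D ≤ low y D + low (7 / 100) (-D) := by
  unfold outside low
  rw [frac_neg hn]
  split_ifs <;> try norm_num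
  all_goals
    rename_i h1 h2 h3
    rcases h1 with h | h
    · exact absurd h h2
    · exact absurd (by linarith) h3

/-- The upper tail is the lower tail of the flipped point, and `1 - 211/250 = 39/250`. -/
theorem integral_outside_le {n : ℕ} (hn : 0 < n) {p : ℝ} (h0 : 0 ≤ p) (h1 : p ≤ 211 / 250) (y : ℝ) :
    ∫ D : Cube n, outside y D ∂flips n p ≤
      ∫ D : Cube n, low y D ∂flips n p + (99 / 100) ^ n := by
  have hp : p ∈ Set.Icc (0 : ℝ) 1 := ⟨h0, by linarith⟩
  have h2 := integral_low_exp_le hn (p := 1 - p) (by linarith) (by linarith)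
  rw [← integral_flips_neg hp] at h2
  calc _ ≤ ∫ D : Cube n, (low y D + low (7 / 100) (-D)) ∂flips n p :=
        integral_mono (integrable_flips hp _) (integrable_flips hp _) (outside_le_low_add hn y)
    _ ≤ _ := by
        rw [integral_add (integrable_flips hp _) (integrable_flips hp _)]
        linarith

theorem chainStep_le_one {n : ℕ} {g : Cube n → ℝ} (hg : ∀ D, g D ≤ 1) (D : Cube n) :
    chainStep g D ≤ 1 := by
  have h := chainStep_mono (g' := fun _ => 1) hg D
  rwa [chainStep_const] at h

theorem chainStep_outside_le {n : ℕ} (hn : 0 < n) (D : Cube n) :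
    chainStep (outside (7 / 100)) D ≤ outside (7 / 100) D + 2 * (99 / 100) ^ n := by
  have hpos : (0 : ℝ) < (99 / 100) ^ n := by positivity
  by_cases h : frac D < 7 / 100 ∨ 93 / 100 < frac D
  · have h1 := chainStep_le_one (outside_le_one (7 / 100)) D
    have h2 : outside (7 / 100) D = 1 := if_pos h
    linarith
  · have h2 : outside (7 / 100) D = 0 := if_neg h
    push Not at h
    have h3 := integral_outside_le hn (phi_nonneg (frac D)) (phi_le_of_le h.2) (7 / 100)
    have h4 := integral_low_exp_le hn (phi_ge_of_ge h.1) (phi_le_one _)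
    rw [h2, chainStep]
    linarith

theorem one_div_le_frac {n : ℕ} (hn : 0 < n) {D : Cube n} (h : 0 < frac D) :
    1 / (n : ℝ) ≤ frac D := by
  have hn' : (0 : ℝ) < n := by exact_mod_cast hn
  unfold frac at h ⊢
  have hc : 0 < (Finset.univ.filter fun i => D i = -1).card := by
    by_contra hc
    simp only [not_lt, Nat.le_zero] at hc
    rw [hc] at h
    simp at h
  gcongr
  exact_mod_cast hc

/-- Only the lower edge moves in the growth phase. The error does not depend on `y`, so the steps
can be summed. -/
theorem chainStep_outside_growth {n : ℕ} (hn : 0 < n) {y y' : ℝ} (hy : 0 < y) (hy1 : y ≤ 7 / 100)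
    (hy' : y' ≤ 11 / 10 * y) (D : Cube n) :
    chainStep (outside y') D ≤ outside y D + (7 / √n + (99 / 100) ^ n) := by
  have hn' : (0 : ℝ) < n := by exact_mod_cast hn
  have hpi := Real.pi_pos
  have hpi' := Real.pi_lt_d2
  by_cases h : frac D < y ∨ 93 / 100 < frac D
  · have h1 := chainStep_le_one (outside_le_one y') D
    have h2 : outside y D = 1 := if_pos h
    have : 0 ≤ 7 / √n + (99 / 100 : ℝ) ^ n := by positivity
    linarith
  · have h2 : outside y D = 0 := if_neg h
    push Not at h
    have hf : 0 < frac D := by linarith [h.1]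
    have hlow := sqrt_le_phi hf.le (frac_le_one D)
    have hp0 : 0 < phi (frac D) := lt_of_lt_of_le (by positivity) hlow
    -- For `y ≤ 7/100` one has `√y ≤ 0.265`, so `phi / 2 ≥ 0.315 √y` exceeds `1.1 y`; the half is
    -- reserved for Chebyshev.
    have hgrow : y' ≤ phi (frac D) / 2 := by
      have hsy : √y ≤ √(frac D) := Real.sqrt_le_sqrt h.1
      have hs : √y ≤ 265 / 1000 := Real.sqrt_le_iff.2 ⟨by norm_num, by linarith⟩
      have hsq : y = √y * √y := (Real.mul_self_sqrt hy.le).symm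
      have hs0 : 0 ≤ √y := Real.sqrt_nonneg y
      have hinv : 63 / 100 ≤ 2 / Real.pi := by
        rw [le_div_iff₀ hpi]; linarith
      have : 63 / 100 * √y ≤ phi (frac D) := le_trans (by gcongr) hlow
      nlinarith
    have h3 := integral_outside_le hn hp0.le (phi_le_of_le h.2) y'
    have h4 := integral_low_le hn hp0 (phi_le_one _) hgrow
    -- A positive fraction is at least `1/n`, so `n * phi` has order at least `√n`; `7` replaces
    -- `2π`.
    have h5 : 4 / (n * phi (frac D)) ≤ 7 / √n := by
      have hfr : 1 / √n ≤ √(frac D) := by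
        rw [← Real.sqrt_one, ← Real.sqrt_div zero_le_one]
        exact Real.sqrt_le_sqrt (one_div_le_frac hn hf)
      have hsn : 0 < √(n : ℝ) := Real.sqrt_pos.2 hn'
      have hge : 2 / Real.pi * (1 / √n) ≤ phi (frac D) := le_trans (by gcongr) hlow
      calc 4 / (n * phi (frac D)) ≤ 4 / (n * (2 / Real.pi * (1 / √n))) := by gcongr
        _ = 2 * Real.pi / √n := by
            have : (n : ℝ) = √n * √n := (Real.mul_self_sqrt hn'.le).symm
            nth_rewrite 1 [this]
            field_simp
            ring
        _ ≤ 7 / √n := by gcongr; linarith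
    rw [h2, chainStep]
    linarith

/-- Inside the window the squared bias contracts by `(4/5)²`; `1/n` is the binomial variance and the
indicator pays for the complement. -/
theorem chainStep_bias_sq_le {n : ℕ} (hn : 0 < n) (D : Cube n) :
    chainStep (fun E => (1 - 2 * frac E) ^ 2) D ≤
      16 / 25 * (1 - 2 * frac D) ^ 2 + 1 / n + outside (7 / 100) D := by
  have hn' : (0 : ℝ) < n := by exact_mod_cast hn
  rw [chainStep, integral_bias_sq hn (phi_mem_Icc _)]
  have h1 : (1 - (1 - 2 * phi (frac D)) ^ 2) / n ≤ 1 / n := by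
    gcongr; linarith [sq_nonneg (1 - 2 * phi (frac D))]
  have h0 := phi_nonneg (frac D)
  have h0' := phi_le_one (frac D)
  by_cases h : frac D < 7 / 100 ∨ 93 / 100 < frac D
  · have h2 : outside (7 / 100) D = 1 := if_pos h
    have : (1 - 2 * phi (frac D)) ^ 2 ≤ 1 := by nlinarith
    nlinarith [sq_nonneg (1 - 2 * frac D)]
  · have h2 : outside (7 / 100) D = 0 := if_neg h
    push Not at h
    have h3 := abs_one_sub_two_mul_phi_le_of_mid h.1 h.2
    have h4 := pow_le_pow_left₀ (abs_nonneg _) h3 2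
    rw [mul_pow, sq_abs, sq_abs] at h4
    linarith

/-! ### Quantitative convergence of the chain -/

/-- The term `4/(n * p)` is the cost of the initial draw and the reason for requiring `n ε_n → ∞`;
each later step raises the lower edge by `11/10` until it is capped. -/
theorem chainExp_outside_growth {n : ℕ} (hn : 0 < n) {p : ℝ} (h0 : 0 < p) (h1 : p ≤ 1 / 2) (s : ℕ) :
    chainExp (n := n) p s (outside (min (7 / 100) ((11 / 10) ^ s * (p / 2)))) ≤
      4 / (n * p) + (99 / 100) ^ n + s * (7 / √n + (99 / 100) ^ n) := by
  have hp : p ∈ Set.Icc (0 : ℝ) 1 := ⟨h0.le, by linarith⟩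
  induction s with
  | zero =>
    have h2 := integral_outside_le hn h0.le (by linarith)
      (min (7 / 100) ((11 / 10) ^ 0 * (p / 2)))
    have h3 := integral_low_le hn h0 hp.2 (y := min (7 / 100) ((11 / 10) ^ 0 * (p / 2)))
      ((min_le_right _ _).trans (by simp))
    simp only [chainExp, Function.iterate_zero, id, Nat.cast_zero, zero_mul, add_zero]
    linarith
  | succ s ih =>
    rw [chainExp_succ]
    have hstep := chainExp_mono hp s (chainStep_outside_growth hn
      (y := min (7 / 100) ((11 / 10) ^ s * (p / 2)))
      (y' := min (7 / 100) ((11 / 10) ^ (s + 1) * (p / 2))) (by positivity) (min_le_left _ _) (by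
        rcases min_cases (7 / 100 : ℝ) ((11 / 10) ^ s * (p / 2)) with ⟨h, -⟩ | ⟨h, -⟩
        · rw [h]; exact (min_le_left _ _).trans (by norm_num)
        · rw [h]; exact (min_le_right _ _).trans (by rw [pow_succ]; linarith)))
    rw [chainExp_add hp, chainExp_const hp] at hstep
    push_cast
    linarith

theorem chainExp_outside_le {n : ℕ} (hn : 0 < n) {p : ℝ} (hp : p ∈ Set.Icc (0 : ℝ) 1) (s r : ℕ) :
    chainExp (n := n) p (s + r) (outside (7 / 100)) ≤
      chainExp (n := n) p s (outside (7 / 100)) + 2 * r * (99 / 100) ^ n := by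
  induction r with
  | zero => simp
  | succ r ih =>
    rw [← add_assoc, chainExp_succ]
    have h := chainExp_mono hp (s + r) (chainStep_outside_le hn)
    rw [chainExp_add hp, chainExp_const hp] at h
    push_cast
    linarith

/-- The factor `3` closes the induction: `(16/25) * 3 + 1 ≤ 3`. -/
theorem chainExp_bias_sq_le {n : ℕ} (hn : 0 < n) {p : ℝ} (hp : p ∈ Set.Icc (0 : ℝ) 1) (s r : ℕ) :
    chainExp (n := n) p (s + r) (fun D => (1 - 2 * frac D) ^ 2) ≤
      (16 / 25) ^ r + 3 * (1 / n + chainExp (n := n) p s (outside (7 / 100)) +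
        2 * r * (99 / 100) ^ n) := by
  have hB : 0 ≤ chainExp (n := n) p s (outside (7 / 100)) := by
    have := chainExp_mono (n := n) hp s (g := fun _ => 0) (outside_nonneg (7 / 100))
    rwa [chainExp_const hp] at this
  have hn' : (0 : ℝ) ≤ 1 / n := by positivity
  have hq : (0 : ℝ) ≤ (99 / 100) ^ n := by positivity
  induction r with
  | zero =>
    have h := chainExp_mono (n := n) hp s (g := fun D => (1 - 2 * frac D) ^ 2) (g' := fun _ => 1)
      (fun D => by have := frac_nonneg D; have := frac_le_one D; nlinarith)
    rw [chainExp_const hp] at h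
    simp only [add_zero, pow_zero, Nat.cast_zero, mul_zero, zero_mul]
    linarith
  | succ r ih =>
    rw [← add_assoc, chainExp_succ]
    have h := chainExp_mono hp (s + r) (chainStep_bias_sq_le hn)
    rw [chainExp_add hp, chainExp_add hp, chainExp_const hp, chainExp_const_mul] at h
    have h2 := chainExp_outside_le hn hp s r
    have h3 : (0 : ℝ) ≤ r * (99 / 100) ^ n := by positivity
    rw [pow_succ]
    push_cast
    linarith

/-- After `s + r` steps the two inputs decorrelate. -/
theorem chainExp_abs_bias_le {n : ℕ} (hn : 0 < n) {p : ℝ} (h0 : 0 < p) (h1 : p ≤ 1 / 2) {s : ℕ}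
    (hs : 7 / 100 ≤ (11 / 10) ^ s * (p / 2)) (r : ℕ) {δ : ℝ} (hδ : 0 < δ) :
    chainExp (n := n) p (s + r) (fun D => |1 - 2 * frac D|) ≤ δ / 2 + 1 / (2 * δ) *
      ((16 / 25) ^ r + 3 * (1 / n + (4 / (n * p) + (99 / 100) ^ n +
        s * (7 / √n + (99 / 100) ^ n)) + 2 * r * (99 / 100) ^ n)) := by
  have hp : p ∈ Set.Icc (0 : ℝ) 1 := ⟨h0.le, by linarith⟩
  -- The inequality `x ≤ δ/2 + x²/(2δ)` replaces Cauchy–Schwarz, so only linearity and monotonicity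
  -- of the chain are used.
  have h := chainExp_mono (n := n) hp (s + r) (g := fun D => |1 - 2 * frac D|)
    (g' := fun D => δ / 2 + 1 / (2 * δ) * (1 - 2 * frac D) ^ 2) (fun D => by
      rw [← sq_abs (1 - 2 * frac D)]
      generalize |1 - 2 * frac D| = x
      have : δ / 2 + 1 / (2 * δ) * x ^ 2 - x = (δ - x) ^ 2 / (2 * δ) := by field_simp; ring
      have : 0 ≤ (δ - x) ^ 2 / (2 * δ) := by positivity
      linarith)
  rw [chainExp_add hp, chainExp_const hp, chainExp_const_mul] at h
  have h2 := chainExp_outside_growth hn h0 h1 s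
  rw [min_eq_left hs] at h2
  have h3 := chainExp_bias_sq_le hn hp s r
  refine h.trans ?_
  gcongr
  linarith

/-! ### Decorrelation at large depth -/

/-- Step `m + 1` resamples the quotient at level `phi (frac D)`. The remaining `k` steps then differ
from a start at `1/2` by at most `|1 - 2 * phi (frac D)|`, whatever `k` is. -/
theorem abs_chainExp_corr_sub_half_le {n : ℕ} {p : ℝ} (hp : p ∈ Set.Icc (0 : ℝ) 1) (m k : ℕ)
    (h : BoolFun n) :
    |chainExp p (m + (k + 1)) (corr h) - chainExp (1 / 2) k (corr h)| ≤
      chainExp (n := n) p m (fun D => |1 - 2 * frac D|) := by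
  rw [chainExp_add_time, sub_eq_add_neg, ← chainExp_const (n := n) hp m (-_), ← chainExp_add hp]
  refine (abs_chainExp_le hp m _).trans (chainExp_mono hp m fun D => ?_)
  rw [Function.iterate_succ_apply', ← sub_eq_add_neg]
  exact (abs_chainExp_corr_sub_le (phi_mem_Icc (frac D)) k h).trans
    (abs_one_sub_two_mul_phi_le (frac_nonneg D) (frac_le_one D))

/-- The error made by the chain after the growth phase. -/
def chainErr (n : ℕ) (p : ℝ) (s : ℕ) : ℝ :=
  1 / n + (4 / (n * p) + (99 / 100) ^ n + s * (7 / √n + (99 / 100) ^ n))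

theorem exists_chainExp_abs_bias_le {η : ℝ} (hη : 0 < η) :
    ∃ (r₀ : ℕ) (c : ℝ), 0 < c ∧ ∀ (n : ℕ) (p : ℝ) (s r : ℕ), 0 < n → 0 < p → p ≤ 1 / 2 →
      7 / 100 ≤ (11 / 10) ^ s * (p / 2) → r₀ ≤ r →
      chainErr n p s + 2 * r * (99 / 100) ^ n ≤ c →
      chainExp (n := n) p (s + r) (fun D => |1 - 2 * frac D|) ≤ η := by
  obtain ⟨r₀, hr₀⟩ := exists_pow_lt_of_lt_one (by positivity : 0 < η ^ 2 / 2)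
    (by norm_num : (16 / 25 : ℝ) < 1)
  -- With `δ = η`, the contraction term and three times the error each contribute at most `η²/2`,
  -- and `η/2 + η²/(2η) = η`.
  refine ⟨r₀, η ^ 2 / 6, by positivity, fun n p s r hn h0 h1 hs hr hc => ?_⟩
  refine (chainExp_abs_bias_le hn h0 h1 hs r hη).trans ?_
  have hpow : (16 / 25 : ℝ) ^ r ≤ (16 / 25) ^ r₀ :=
    pow_le_pow_of_le_one (by norm_num) (by norm_num) hr
  unfold chainErr at hc
  calc _ ≤ η / 2 + 1 / (2 * η) * η ^ 2 := by gcongr; linarith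
    _ = η := by field_simp; ring

/-- The length of the growth phase from noise level `p`. -/
def growthTime (p : ℝ) : ℕ := ⌈11 * Real.log (1 / p)⌉₊

/-- As `log (11/10) ≥ 1/11`, this many steps multiply by at least `1/p`, lifting `p/2` to `1/2`. -/
theorem growthTime_spec {p : ℝ} (h0 : 0 < p) (h1 : p ≤ 1 / 2) :
    7 / 100 ≤ (11 / 10) ^ growthTime p * (p / 2) := by
  have hlog : 1 / 11 ≤ Real.log (11 / 10) := by
    have := Real.one_sub_inv_le_log_of_pos (by norm_num : (0 : ℝ) < 11 / 10)
    norm_num at this ⊢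
    exact this
  have hs : 11 * Real.log (1 / p) ≤ growthTime p := Nat.le_ceil _
  have hL : 0 ≤ Real.log (1 / p) :=
    Real.log_nonneg (by rw [le_div_iff₀ h0]; linarith)
  have hge : 1 / p ≤ (11 / 10 : ℝ) ^ growthTime p := by
    rw [← Real.log_le_log_iff (by positivity) (by positivity), Real.log_pow]
    nlinarith
  calc (7 / 100 : ℝ) ≤ 1 / p * (p / 2) := by field_simp; norm_num
    _ ≤ _ := by gcongr

theorem growthTime_le {p : ℝ} (h0 : 0 < p) (h1 : p ≤ 1 / 2) :
    (growthTime p : ℝ) ≤ 11 * Real.log (1 / p) + 1 := by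
  refine (Nat.ceil_lt_add_one ?_).le
  have : 0 ≤ Real.log (1 / p) := Real.log_nonneg (by rw [le_div_iff₀ h0]; linarith)
  positivity

/-- Eventually `n * ε n ≥ 1`, so the growth time is `O(log n)` and the accumulated error of order
`log n / √n` vanishes. -/
theorem tendsto_chainErr {ε : ℕ → ℝ} (hε : ∀ n, ε n ≤ 1 / 2)
    (hn : Tendsto (fun n : ℕ => (n : ℝ) * ε n) atTop atTop) :
    Tendsto (fun n => chainErr n (ε n) (growthTime (ε n))) atTop (𝓝 0) := by
  have hsqrt : Tendsto (fun n : ℕ => √(n : ℝ)) atTop atTop :=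
    Real.tendsto_sqrt_atTop.comp tendsto_natCast_atTop_atTop
  have h1 : Tendsto (fun n : ℕ => 1 / (n : ℝ)) atTop (𝓝 0) := tendsto_one_div_atTop_nhds_zero_nat
  have h2 : Tendsto (fun n : ℕ => 4 / ((n : ℝ) * ε n)) atTop (𝓝 0) := hn.const_div_atTop 4
  have h3 : Tendsto (fun n : ℕ => (99 / 100 : ℝ) ^ n) atTop (𝓝 0) :=
    tendsto_pow_atTop_nhds_zero_of_lt_one (by norm_num) (by norm_num)
  have h4 : Tendsto (fun n : ℕ => (n : ℝ) * (99 / 100 : ℝ) ^ n) atTop (𝓝 0) :=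
    tendsto_self_mul_const_pow_of_lt_one (by norm_num) (by norm_num)
  have h5 : Tendsto (fun n : ℕ => 7 / √(n : ℝ)) atTop (𝓝 0) := hsqrt.const_div_atTop 7
  have h6 : Tendsto (fun n : ℕ => Real.log n / √(n : ℝ)) atTop (𝓝 0) := by
    have h := ((Real.tendsto_pow_log_div_mul_add_atTop 1 0 1 one_ne_zero).comp hsqrt).const_mul 2
    rw [mul_zero] at h
    refine h.congr fun n => ?_
    simp only [Function.comp_apply, pow_one, one_mul, add_zero]
    rw [Real.log_sqrt (Nat.cast_nonneg n)]
    ring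
  have h7 : Tendsto (fun n => (growthTime (ε n) : ℝ) * (7 / √(n : ℝ) + (99 / 100) ^ n)) atTop
      (𝓝 0) := by
    have hub : Tendsto (fun n : ℕ => 77 * (Real.log n / √(n : ℝ)) + 7 / √(n : ℝ) +
        11 * ((n : ℝ) * (99 / 100) ^ n) + (99 / 100) ^ n) atTop (𝓝 0) := by
      simpa using (((h6.const_mul 77).add h5).add (h4.const_mul 11)).add h3
    refine squeeze_zero' (Eventually.of_forall fun n => by positivity) ?_ hub
    filter_upwards [hn.eventually_ge_atTop 1, eventually_gt_atTop 0] with n hn1 hn0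
    have hn0' : (0 : ℝ) < n := by exact_mod_cast hn0
    have hpos : 0 < ε n := by
      by_contra hneg
      push Not at hneg
      nlinarith
    have hg := growthTime_le hpos (hε n)
    have hlog : Real.log (1 / ε n) ≤ Real.log n :=
      Real.log_le_log (by positivity) (by rw [div_le_iff₀ hpos]; exact hn1)
    have hlog' : Real.log n ≤ n := (Real.log_le_sub_one_of_pos hn0').trans (by linarith)
    have hg1 : (growthTime (ε n) : ℝ) ≤ 11 * Real.log n + 1 := by linarith
    have hg2 : (growthTime (ε n) : ℝ) ≤ 11 * n + 1 := by linarith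
    rw [mul_add]
    have e1 : (growthTime (ε n) : ℝ) * (7 / √(n : ℝ)) ≤ (11 * Real.log n + 1) * (7 / √(n : ℝ)) := by
      gcongr
    have e2 : (growthTime (ε n) : ℝ) * (99 / 100) ^ n ≤ (11 * n + 1) * (99 / 100) ^ n := by gcongr
    have e3 : (11 * Real.log n + 1) * (7 / √(n : ℝ)) =
      77 * (Real.log n / √(n : ℝ)) + 7 / √(n : ℝ) := by ring
    linarith
  unfold chainErr
  simpa using h1.add ((h2.add h3).add h7)

theorem eventually_growthTime_add_le {ε K : ℕ → ℝ} (hε : ∀ n, ε n ≤ 1 / 2)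
    (h0 : Tendsto ε atTop (𝓝 0)) (hpos : ∀ᶠ n in atTop, 0 < ε n)
    (hK : Tendsto (fun n : ℕ => K n / Real.log (1 / ε n)) atTop atTop) (R : ℕ) :
    ∀ᶠ n in atTop, ((growthTime (ε n) + R : ℕ) : ℝ) ≤ K n := by
  have hL : Tendsto (fun n => Real.log (1 / ε n)) atTop atTop := by
    refine Real.tendsto_log_atTop.comp ?_
    have : Tendsto ε atTop (𝓝[>] 0) := tendsto_nhdsWithin_iff.2 ⟨h0, hpos⟩
    simp only [one_div]
    exact this.inv_tendsto_nhdsGT_zero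
  -- The ratio `12` against the `11` in `growthTime` leaves a spare `log (1 / ε n)`, which absorbs
  -- the rounding and `R`.
  filter_upwards [hpos, hK.eventually_ge_atTop 12, hL.eventually_ge_atTop (R + 1)] with n hp h12 hR
  have hLpos : 0 < Real.log (1 / ε n) := lt_of_lt_of_le (by positivity) hR
  rw [le_div_iff₀ hLpos] at h12
  have := growthTime_le hp (hε n)
  push_cast
  linarith

theorem eventually_pos_of_tendsto_mul {ε : ℕ → ℝ}
    (hn : Tendsto (fun n : ℕ => (n : ℝ) * ε n) atTop atTop) : ∀ᶠ n in atTop, 0 < ε n := by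
  filter_upwards [hn.eventually_gt_atTop 0] with n h
  by_contra hneg
  push Not at hneg
  have : (0 : ℝ) ≤ n := Nat.cast_nonneg n
  nlinarith

/-- At any noise level above `ε n` the chain is mixed after the growth phase and a bounded number
of further steps. -/
theorem eventually_chainExp_abs_bias_le {ε : ℕ → ℝ} (hε : ∀ n, ε n ≤ 1 / 2)
    (hn : Tendsto (fun n : ℕ => (n : ℝ) * ε n) atTop atTop) {η : ℝ} (hη : 0 < η) :
    ∃ r : ℕ, ∀ᶠ n in atTop, ∀ p, ε n ≤ p → p ≤ 1 / 2 →
      chainExp (n := n) p (growthTime (ε n) + r) (fun D => |1 - 2 * frac D|) ≤ η := by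
  obtain ⟨r, c, hc, H⟩ := exists_chainExp_abs_bias_le hη
  refine ⟨r, ?_⟩
  have h3 : Tendsto (fun n : ℕ => (99 / 100 : ℝ) ^ n) atTop (𝓝 0) :=
    tendsto_pow_atTop_nhds_zero_of_lt_one (by norm_num) (by norm_num)
  have ht := (tendsto_chainErr hε hn).add (h3.const_mul (2 * (r : ℝ)))
  rw [mul_zero, add_zero] at ht
  filter_upwards [ht.eventually_le_const hc, eventually_pos_of_tendsto_mul hn,
    eventually_gt_atTop 0] with n h1 h2 h4 p hp1 hp2
  have h4' : (0 : ℝ) < n := by exact_mod_cast h4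
  refine H n p _ r h4 (h2.trans_le hp1) hp2
    ((growthTime_spec h2 (hε n)).trans (by gcongr)) le_rfl (le_trans ?_ h1)
  unfold chainErr
  gcongr

/-- All layers but the last serve mixing, so `k = 0` and the reference value is the squared mean.
The depth cap keeps the accumulated escape probability small: growth rate at most `1/200` against
decay rate at least `1/100`. -/
theorem annealedQNS_of_le_exp {ε K : ℕ → ℝ} (hε : ∀ n, ε n ≤ 1 / 2)
    (h0 : Tendsto ε atTop (𝓝 0)) (hn : Tendsto (fun n : ℕ => (n : ℝ) * ε n) atTop atTop)
    (hK : Tendsto (fun n : ℕ => K n / Real.log (1 / ε n)) atTop atTop)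
    {b : ℕ → ℝ} {T : ℕ → ℕ} (h : ∀ n, BoolFun n) (hb : Tendsto b atTop (𝓝 0))
    (hT : ∀ᶠ n : ℕ in atTop, K n ≤ (T n : ℝ) ∧ (T n : ℝ) ≤ Real.exp (b n * n)) :
    AnnealedQNS (fun n => netLaw (T n) (h n)) ε := by
  have hpos := eventually_pos_of_tendsto_mul hn
  refine Metric.tendsto_nhds.2 fun η hη => ?_
  obtain ⟨r₀, c, hc, H⟩ := exists_chainExp_abs_bias_le (half_pos hη)
  have hlog : Real.log (99 / 100) ≤ -(1 / 100) := by
    have := Real.log_le_sub_one_of_pos (by norm_num : (0 : ℝ) < 99 / 100)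
    linarith
  have hexp : Tendsto (fun n : ℕ => 2 * Real.exp (-(1 / 200) * n)) atTop (𝓝 0) := by
    have : Tendsto (fun n : ℕ => -(1 / 200) * (n : ℝ)) atTop atBot :=
      tendsto_natCast_atTop_atTop.const_mul_atTop_of_neg (by norm_num)
    simpa using (Real.tendsto_exp_atBot.comp this).const_mul 2
  have ht := (tendsto_chainErr hε hn).add hexp
  rw [add_zero] at ht
  filter_upwards [ht.eventually_le_const hc, hpos, eventually_gt_atTop 0, hT,
    eventually_growthTime_add_le hε h0 hpos hK (r₀ + 1),
    hb.eventually_le_const (by norm_num : (0 : ℝ) < 1 / 200)] with n h1 h2 h4 h5 h6 h7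
  have hn0 : (0 : ℝ) < n := by exact_mod_cast h4
  have hTn : growthTime (ε n) + (r₀ + 1) ≤ T n := by exact_mod_cast h6.trans h5.1
  obtain ⟨r, hr⟩ : ∃ r, T n = growthTime (ε n) + r + (0 + 1) ∧ r₀ ≤ r :=
    ⟨T n - growthTime (ε n) - 1, by omega, by omega⟩
  have hp : ε n ∈ Set.Icc (0 : ℝ) 1 := ⟨h2.le, by linarith [hε n]⟩
  have hrT : (r : ℝ) ≤ Real.exp (b n * n) := le_trans (by exact_mod_cast (by omega)) h5.2
  have hsmall : 2 * r * (99 / 100 : ℝ) ^ n ≤ 2 * Real.exp (-(1 / 200) * n) := by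
    have e : (99 / 100 : ℝ) ^ n = Real.exp (n * Real.log (99 / 100)) := by
      rw [mul_comm, Real.exp_mul, Real.exp_log (by norm_num), Real.rpow_natCast]
    calc 2 * r * (99 / 100 : ℝ) ^ n ≤ 2 * Real.exp (b n * n) * (99 / 100) ^ n := by gcongr
      _ = 2 * Real.exp (b n * n + n * Real.log (99 / 100)) := by rw [e, Real.exp_add]; ring
      _ ≤ _ := by gcongr; nlinarith
  have hb := H n (ε n) _ r h4 h2 (hε n) (growthTime_spec h2 (hε n)) hr.2 (by linarith)
  have hA := abs_chainExp_corr_sub_half_le hp (growthTime (ε n) + r) 0 (h n)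
  rw [← hr.1] at hA
  have e0 : chainExp (1 / 2) 0 (corr (h n)) = cubeMean (h n) ^ 2 := integral_corr_half (h n)
  rw [Real.dist_eq, sub_zero, annealedCov_eq hp, ← e0]
  linarith

theorem corr_neg_of_odd {n : ℕ} {h : BoolFun n} (hh : ∀ ω, h (-ω) = -h ω) (D : Cube n) :
    corr h (-D) = -corr h D := by
  simp only [corr, pairAvg, mul_neg, hh, toReal_neg, integral_neg]

/-- Mixing uses the growth time and boundedly many steps; the remaining depth `k` is unrestricted
since the restarted expectation is `0` for every `k`. -/
theorem annealedQNS_of_odd {ε K : ℕ → ℝ} (hε : ∀ n, ε n ≤ 1 / 2)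
    (h0 : Tendsto ε atTop (𝓝 0)) (hn : Tendsto (fun n : ℕ => (n : ℝ) * ε n) atTop atTop)
    (hK : Tendsto (fun n : ℕ => K n / Real.log (1 / ε n)) atTop atTop)
    {T : ℕ → ℕ} {h : ∀ n, BoolFun n} (hodd : ∀ n, 1 ≤ n → ∀ ω, h n (-ω) = -h n ω)
    (hT : ∀ᶠ n : ℕ in atTop, K n ≤ (T n : ℝ)) :
    AnnealedQNS (fun n => netLaw (T n) (h n)) ε := by
  have hpos := eventually_pos_of_tendsto_mul hn
  refine Metric.tendsto_nhds.2 fun η hη => ?_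
  obtain ⟨r, hr⟩ := eventually_chainExp_abs_bias_le hε hn (half_pos hη)
  filter_upwards [hr, hpos, eventually_gt_atTop 0, hT,
    eventually_growthTime_add_le hε h0 hpos hK (r + 1)] with n h1 h2 h4 h5 h6
  have hTn : growthTime (ε n) + (r + 1) ≤ T n := by exact_mod_cast h6.trans h5
  obtain ⟨k, hk⟩ : ∃ k, T n = growthTime (ε n) + r + (k + 1) :=
    ⟨T n - growthTime (ε n) - r - 1, by omega⟩
  have hp : ε n ∈ Set.Icc (0 : ℝ) 1 := ⟨h2.le, by linarith [hε n]⟩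
  have hA := abs_chainExp_corr_sub_half_le hp (growthTime (ε n) + r) k (h n)
  have hc := corr_neg_of_odd (hodd n h4)
  have e0 : chainExp (1 / 2) 0 (corr (h n)) = cubeMean (h n) ^ 2 := integral_corr_half (h n)
  rw [← hk, chainExp_half_of_odd h4 hc] at hA
  rw [Real.dist_eq, sub_zero, annealedCov_eq hp, ← e0, chainExp_half_of_odd h4 hc]
  linarith [h1 (ε n) le_rfl (hε n)]

theorem one_sub_le_measureReal_lt {α : Type*} [MeasurableSpace α] [Finite α]
    [MeasurableSingletonClass α] {μ : Measure α} [IsProbabilityMeasure μ] {X : α → ℝ}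
    (hX : ∀ a, 0 ≤ X a) {δ : ℝ} (hδ : 0 < δ) (h : ∫ a, X a ∂μ ≤ δ * δ) :
    1 - δ ≤ μ.real {a | X a < δ} := by
  have h1 := mul_meas_ge_le_integral_of_nonneg (μ := μ) (Eventually.of_forall hX)
    Integrable.of_finite δ
  have h2 : μ.real {a | δ ≤ X a} ≤ δ := le_of_mul_le_mul_left (h1.trans h) hδ
  have h3 : {a | X a < δ} = {a | δ ≤ X a}ᶜ := by ext a; simp
  rw [h3, probReal_compl_eq_one_sub (Set.toFinite _).measurableSet]
  linarith

/-- The starts `ε n` and `1/2` are each within `δ²/2` of the same chain restarted at `1/2` with `k`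
steps, so the mean quenched covariance is at most `δ²`. -/
theorem quenchedQNS {ε K : ℕ → ℝ} (hε : ∀ n, ε n ≤ 1 / 2)
    (h0 : Tendsto ε atTop (𝓝 0)) (hn : Tendsto (fun n : ℕ => (n : ℝ) * ε n) atTop atTop)
    (hK : Tendsto (fun n : ℕ => K n / Real.log (1 / ε n)) atTop atTop)
    {T : ℕ → ℕ} (h : ∀ n, BoolFun n) (hT : ∀ᶠ n : ℕ in atTop, K n ≤ (T n : ℝ)) :
    QuenchedQNS (fun n => netLaw (T n) (h n)) ε := by
  have hpos := eventually_pos_of_tendsto_mul hn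
  intro δ hδ
  obtain ⟨r, hr⟩ := eventually_chainExp_abs_bias_le hε hn (by positivity : 0 < δ * δ / 2)
  rw [← eventually_atTop]
  filter_upwards [hr, hpos, hT,
    eventually_growthTime_add_le hε h0 hpos hK (r + 1)] with n h1 h2 h5 h6
  have hTn : growthTime (ε n) + (r + 1) ≤ T n := by exact_mod_cast h6.trans h5
  obtain ⟨k, hk⟩ : ∃ k, T n = growthTime (ε n) + r + (k + 1) :=
    ⟨T n - growthTime (ε n) - r - 1, by omega⟩
  have hp : ε n ∈ Set.Icc (0 : ℝ) 1 := ⟨h2.le, by linarith [hε n]⟩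
  have hA := abs_chainExp_corr_sub_half_le hp (growthTime (ε n) + r) k (h n)
  have hB := abs_chainExp_corr_sub_half_le half_mem_Icc (growthTime (ε n) + r) k (h n)
  rw [← hk] at hA hB
  have hA' := h1 (ε n) le_rfl (hε n)
  have hB' := h1 (1 / 2) (hε n) le_rfl
  have hnn : ∀ f : BoolFun n, 0 ≤ noiseCov f (ε n) := fun f => by
    rw [noiseCov_eq hp]; exact integral_corr_sub_nonneg h2.le (hε n) f
  refine (one_sub_le_measureReal_lt (μ := netLaw (T n) (h n)) hnn hδ ?_).trans
    (measureReal_mono fun f (hf : noiseCov f (ε n) < δ) => hf.le)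
  rw [integral_noiseCov_netLaw hp]
  have := (abs_le.1 hA).2
  have := (abs_le.1 hB).1
  linarith

/-! ### Coalescence at very large depth -/

/-- The indicator of a quotient other than `1` and `-1`. -/
def separated {n : ℕ} (D : Cube n) : ℝ := if D = 1 ∨ D = -1 then 0 else 1

theorem separated_le_one {n : ℕ} (D : Cube n) : separated D ≤ 1 := by
  unfold separated; split_ifs <;> norm_num

theorem integral_separated_le {n : ℕ} {p : ℝ} (hp : p ∈ Set.Icc (0 : ℝ) 1) (v : ℤˣ) :
    ∫ D : Cube n, separated D ∂flips n p ≤ 1 - (if v = 1 then 1 - p else p) ^ n := by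
  have := isProbabilityMeasure_flips n hp
  have hw := integral_prod_flips (n := n) hp (fun _ u => if u = v then (1 : ℝ) else 0)
  have h1 : (1 - p) * (if (1 : ℤˣ) = v then (1 : ℝ) else 0) +
      p * (if (-1 : ℤˣ) = v then (1 : ℝ) else 0) = if v = 1 then 1 - p else p := by
    rcases Int.units_eq_one_or v with rfl | rfl <;> simp
  rw [Finset.prod_const, Finset.card_univ, Fintype.card_fin, h1] at hw
  rw [← hw]
  calc _ ≤ ∫ D : Cube n, (1 - ∏ i, if D i = v then (1 : ℝ) else 0) ∂flips n p := by
        refine integral_mono (integrable_flips hp _) (integrable_flips hp _) fun D => ?_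
        simp only
        by_cases hD : ∀ i, D i = v
        · have hD' : D = 1 ∨ D = -1 := by
            rcases Int.units_eq_one_or v with rfl | rfl
            · exact Or.inl (funext hD)
            · exact Or.inr (funext hD)
          simp [separated, hD', hD]
        · push Not at hD
          obtain ⟨i, hi⟩ := hD
          rw [Finset.prod_eq_zero (Finset.mem_univ i) (if_neg hi), sub_zero]
          exact separated_le_one D
    _ = _ := by
        rw [integral_sub (integrable_flips hp _) (integrable_flips hp _)]
        simp

theorem frac_one {n : ℕ} : frac (1 : Cube n) = 0 := by simp [frac]

/-- Since `phi 0 = 0` and `phi 1 = 1`, the points `1` and `-1` are absorbing. From elsewhere, the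
likelier sign fills all coordinates with probability at least `2^{-n}`. -/
theorem chainStep_separated_le {n : ℕ} (hn : 0 < n) (D : Cube n) :
    chainStep separated D ≤ (1 - (1 / 2) ^ n) * separated D := by
  have h1 := integral_separated_le (n := n) (phi_mem_Icc (frac D)) 1
  have h2 := integral_separated_le (n := n) (phi_mem_Icc (frac D)) (-1)
  rw [if_pos rfl] at h1
  rw [if_neg (by decide)] at h2
  by_cases hD : D = 1 ∨ D = -1
  · have hs : separated D = 0 := if_pos hD
    rw [hs, mul_zero, chainStep]
    rcases hD with rfl | rfl
    · rw [frac_one, phi_zero] at h1 ⊢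
      simpa using h1
    · rw [frac_neg hn, frac_one, sub_zero, phi_one] at h2 ⊢
      simpa using h2
  · have hs : separated D = 1 := if_neg hD
    rw [hs, mul_one, chainStep]
    rcases le_total (phi (frac D)) (1 / 2) with h | h
    · have := pow_le_pow_left₀ (by norm_num) (by linarith : (1 / 2 : ℝ) ≤ 1 - phi (frac D)) n
      linarith
    · have := pow_le_pow_left₀ (by norm_num) h n
      linarith

theorem chainExp_separated_le {n : ℕ} (hn : 0 < n) {p : ℝ} (hp : p ∈ Set.Icc (0 : ℝ) 1) (t : ℕ) :
    chainExp (n := n) p t separated ≤ (1 - (1 / 2) ^ n) ^ t := by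
  have hq : (0 : ℝ) ≤ 1 - (1 / 2) ^ n := by
    rw [sub_nonneg]; exact pow_le_one₀ (by norm_num) (by norm_num)
  induction t with
  | zero =>
    have := chainExp_mono (n := n) hp 0 separated_le_one
    rwa [chainExp_const hp] at this
  | succ t ih =>
    rw [chainExp_succ]
    have h := chainExp_mono hp t (chainStep_separated_le hn)
    rw [chainExp_const_mul] at h
    rw [pow_succ']
    exact h.trans (by gcongr)

theorem abs_corr_le_one {n : ℕ} (h : BoolFun n) (D : Cube n) : |corr h D| ≤ 1 := by
  have hu : ∀ u v : ℤˣ, |toReal u * toReal v| = 1 := by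
    intro u v
    rcases Int.units_eq_one_or u with rfl | rfl <;>
      rcases Int.units_eq_one_or v with rfl | rfl <;> simp [toReal]
  unfold corr pairAvg
  refine (abs_integral_le_integral_abs).trans ?_
  simp only [hu, integral_const, probReal_univ, one_smul, le_refl]

theorem le_corr_of_even {n : ℕ} {h : BoolFun n} (hh : ∀ ω, h (-ω) = h ω) (D : Cube n) :
    1 + (-2) * separated D ≤ corr h D := by
  by_cases hD : D = 1 ∨ D = -1
  · have hs : separated D = 0 := if_pos hD
    have hc : corr h D = 1 := by
      rcases hD with rfl | rfl
      · exact corr_one h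
      · rw [← corr_one h]
        simp only [corr, pairAvg, mul_neg, hh]
    rw [hs, hc]; norm_num
  · have hs : separated D = 1 := if_neg hD
    rw [hs]
    linarith [(abs_le.1 (abs_corr_le_one h D)).1]

/-- The product of the first two coordinates. -/
def parityTwo (n : ℕ) : BoolFun n :=
  if hn : 2 ≤ n then fun ω => ω ⟨0, by omega⟩ * ω ⟨1, by omega⟩ else fun _ => 1

theorem parityTwo_neg (n : ℕ) (ω : Cube n) : parityTwo n (-ω) = parityTwo n ω := by
  unfold parityTwo
  split_ifs <;> simp

theorem cubeMean_parityTwo {n : ℕ} (hn : 2 ≤ n) : cubeMean (parityTwo n) = 0 := by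
  have hne : (⟨0, by omega⟩ : Fin n) ≠ ⟨1, by omega⟩ := by simp
  have h := integral_toReal_mul (n := n) half_mem_Icc ⟨0, by omega⟩ ⟨1, by omega⟩
  rw [if_neg hne] at h
  simp only [cubeMean, parityTwo, dif_pos hn, toReal_mul]
  rw [h]; norm_num

/-- Level `1/2` already fails: an even function of mean zero has annealed covariance at least `1 - 2
* (1/4)` once the pair has met up to sign with probability above `3/4`. -/
theorem exists_not_annealedNoiseSensitive :
    ∃ (h : ∀ n, BoolFun n) (τ : ℕ → ℕ), ∀ T : ℕ → ℕ, (∀ᶠ n : ℕ in atTop, τ n ≤ T n) →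
      ¬ AnnealedNoiseSensitive (fun n => netLaw (T n) (h n)) := by
  have hτ : ∀ n : ℕ, ∃ τ : ℕ, (1 - (1 / 2 : ℝ) ^ n) ^ τ < 1 / 4 := fun n =>
    exists_pow_lt_of_lt_one (by norm_num) (by
      have : (0 : ℝ) < (1 / 2) ^ n := by positivity
      linarith)
  choose τ hτ using hτ
  refine ⟨parityTwo, τ, fun T hT hsens => ?_⟩
  have hlim := hsens (1 / 2) (by norm_num) le_rfl
  obtain ⟨n, h1, h2, h3⟩ := ((hlim.eventually_lt_const (by norm_num : (0 : ℝ) < 1 / 2)).and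
    (hT.and (eventually_ge_atTop 2))).exists
  rw [annealedCov_eq half_mem_Icc, cubeMean_parityTwo h3] at h1
  have hm := chainExp_mono half_mem_Icc (T n) (le_corr_of_even (parityTwo_neg n))
  rw [chainExp_add half_mem_Icc, chainExp_const half_mem_Icc, chainExp_const_mul] at hm
  have hs := chainExp_separated_le (n := n) (by omega) half_mem_Icc (T n)
  have hpow : (1 - (1 / 2 : ℝ) ^ n) ^ T n ≤ (1 - (1 / 2) ^ n) ^ τ n :=
    pow_le_pow_of_le_one (by rw [sub_nonneg]; exact pow_le_one₀ (by norm_num) (by norm_num))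
      (by have : (0 : ℝ) < (1 / 2) ^ n := by positivity
          linarith) h2
  linarith [hτ n]

/-! ### Stability at bounded depth -/

/-- The probability that `h` separates a uniform point from its translate. -/
def disagree {n : ℕ} (h : BoolFun n) : Cube n → ℝ :=
  pairAvg fun q => if h q.1 ≠ h q.2 then 1 else 0

theorem noisePair_real_ne {n : ℕ} {p : ℝ} (hp : p ∈ Set.Icc (0 : ℝ) 1) (h : BoolFun n) :
    (noisePair n p).real {q | h q.1 ≠ h q.2} = ∫ D, disagree h D ∂flips n p := by
  rw [disagree, ← integral_noisePair hp, ← integral_indicator_one (Set.toFinite _).measurableSet]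
  refine integral_congr_ae (Eventually.of_forall fun q => ?_)
  simp [Set.indicator_apply]

theorem integral_noisePair_real_ne {n : ℕ} {p : ℝ} (hp : p ∈ Set.Icc (0 : ℝ) 1) (T : ℕ)
    (h : BoolFun n) :
    ∫ f, (noisePair n p).real {q | f q.1 ≠ f q.2} ∂netLaw T h = chainExp p T (disagree h) := by
  have := integral_netLaw_prod T h hp (fun q => if q.1 ≠ q.2 then 1 else 0)
  rw [disagree, ← this]
  refine integral_congr_ae (Eventually.of_forall fun f => ?_)
  simp only
  rw [noisePair_real_ne hp, disagree, ← integral_noisePair hp]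

theorem prod_noisePair_ne {n : ℕ} {p : ℝ} (hp : p ∈ Set.Icc (0 : ℝ) 1) (T : ℕ) (h : BoolFun n) :
    ((netLaw T h).prod (noisePair n p)) {q | q.1 q.2.1 ≠ q.1 q.2.2} =
      ENNReal.ofReal (chainExp p T (disagree h)) := by
  have := isProbabilityMeasure_noisePair n hp
  rw [← integral_noisePair_real_ne hp, Measure.prod_apply (Set.toFinite _).measurableSet,
    ofReal_integral_eq_lintegral_ofReal Integrable.of_finite
      (Eventually.of_forall fun f => measureReal_nonneg)]
  refine lintegral_congr fun f => ?_
  rw [ofReal_measureReal]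
  rfl

theorem integral_flips_zero {n : ℕ} (g : Cube n → ℝ) : ∫ D, g D ∂flips n 0 = g 1 := by
  have hp := isProbabilityMeasure_flips n (p := 0) (by norm_num)
  have hp' := isProbabilityMeasure_flipLaw (p := 0) (by norm_num)
  have h : flips n 0 {1} = 1 := by
    rw [flips, Measure.pi_singleton]
    simp [flipLaw_singleton_one]
  have hae : ∀ᵐ D ∂flips n 0, D = 1 :=
    (prob_compl_eq_zero_iff (measurableSet_singleton _)).2 h
  rw [integral_congr_ae (g := fun _ => g 1) (hae.mono fun D hD => by simp only [hD])]
  simp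

theorem disagree_le_one {n : ℕ} (h : BoolFun n) (D : Cube n) : disagree h D ≤ 1 := by
  calc disagree h D ≤ ∫ _, (1 : ℝ) ∂flips n (1 / 2) :=
        integral_mono Integrable.of_finite Integrable.of_finite fun u => by
          simp only; split_ifs <;> norm_num
    _ = 1 := by rw [integral_const, probReal_univ, one_smul]

theorem exists_noise_le_of_noiseStable {h : ∀ n, BoolFun n} (hh : NoiseStable h) {δ : ℝ}
    (hδ : 0 < δ) : ∃ η : ℝ, 0 < η ∧ η ≤ 1 / 2 ∧ ∀ p, 0 ≤ p → p < η → ∀ n,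
      ∫ D, disagree (h n) D ∂flips n p ≤ δ := by
  have h1 := ENNReal.tendsto_nhds_zero.1 hh (ENNReal.ofReal δ) (by simpa using hδ)
  obtain ⟨η, hη, hsub⟩ := mem_nhdsGT_iff_exists_Ioo_subset.1 h1
  refine ⟨min η (1 / 2), lt_min hη (by norm_num), min_le_right _ _, fun p hp0 hp1 n => ?_⟩
  -- Level `0` is needed because `phi (frac D) = 0` at `D = 1`, while the limit defining stability
  -- sees only positive levels.
  rcases hp0.eq_or_lt with rfl | hp0
  · rw [integral_flips_zero]
    simp only [disagree, pairAvg, mul_one, ne_eq, not_true_eq_false, if_false, integral_zero]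
    exact hδ.le
  · have hp : p ∈ Set.Icc (0 : ℝ) 1 := ⟨hp0.le, by linarith [lt_min_iff.1 hp1]⟩
    have h2 := hsub ⟨hp0, (lt_min_iff.1 hp1).1⟩
    have h3 := (le_iSup (fun n => noisePair n p {q | h n q.1 ≠ h n q.2}) n).trans h2
    rw [← noisePair_real_ne hp]
    exact ENNReal.toReal_le_of_le_ofReal hδ.le h3

/-- The bound `phi x ≤ √x` made affine in `x`, with a free parameter `a`, so that it passes through
chain expectations. -/
theorem phi_frac_le {n : ℕ} {a : ℝ} (ha : 0 < a) (D : Cube n) :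
    phi (frac D) ≤ a / 2 + 1 / (2 * a) * frac D := by
  refine (phi_le_sqrt (frac_nonneg D) (frac_le_one D)).trans ?_
  have hx : frac D = √(frac D) ^ 2 := (Real.sq_sqrt (frac_nonneg D)).symm
  nth_rewrite 2 [hx]
  generalize √(frac D) = x
  have : a / 2 + 1 / (2 * a) * x ^ 2 - x = (a - x) ^ 2 / (2 * a) := by field_simp; ring
  have : 0 ≤ (a - x) ^ 2 / (2 * a) := by positivity
  linarith

theorem integral_frac_le {n : ℕ} {p : ℝ} (hp : p ∈ Set.Icc (0 : ℝ) 1) :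
    ∫ D : Cube n, frac D ∂flips n p ≤ p := by
  rcases Nat.eq_zero_or_pos n with rfl | hn
  · simpa [frac] using hp.1
  · exact (integral_frac hn hp).le

/-- One step costs a square root: mean distance `δ²` before it gives at most `δ` after it, uniformly
in `n`. -/
theorem exists_chainExp_frac_le (t : ℕ) {δ : ℝ} (hδ : 0 < δ) :
    ∃ p₀ : ℝ, 0 < p₀ ∧ p₀ ≤ 1 / 2 ∧ ∀ p, 0 < p → p < p₀ → ∀ n,
      chainExp (n := n) p t frac ≤ δ := by
  induction t generalizing δ with
  | zero =>
    refine ⟨min δ (1 / 2), by positivity, min_le_right _ _, fun p h0 h1 n => ?_⟩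
    have h2 := lt_min_iff.1 h1
    exact (integral_frac_le ⟨h0.le, by linarith⟩).trans h2.1.le
  | succ t ih =>
    obtain ⟨p₀, hp₀, hp₁, H⟩ := ih (by positivity : 0 < δ * δ)
    refine ⟨p₀, hp₀, hp₁, fun p h0 h1 n => ?_⟩
    have hp : p ∈ Set.Icc (0 : ℝ) 1 := ⟨h0.le, by linarith⟩
    have h2 := chainExp_mono (n := n) hp t (g := chainStep frac) fun D =>
      (integral_frac_le (phi_mem_Icc (frac D))).trans (phi_frac_le hδ D)
    rw [chainExp_add hp, chainExp_const hp, chainExp_const_mul] at h2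
    rw [chainExp_succ]
    calc _ ≤ δ / 2 + 1 / (2 * δ) * (δ * δ) :=
          h2.trans (by gcongr; exact H p h0 h1 n)
      _ = δ := by field_simp; ring

theorem exists_chainExp_disagree_le {h : ∀ n, BoolFun n} (hh : NoiseStable h) (T : ℕ) {δ : ℝ}
    (hδ : 0 < δ) : ∃ p₀ : ℝ, 0 < p₀ ∧ p₀ ≤ 1 / 2 ∧ ∀ p, 0 < p → p < p₀ → ∀ n,
      chainExp p T (disagree (h n)) ≤ δ := by
  cases T with
  | zero =>
    obtain ⟨η, h1, h2, H⟩ := exists_noise_le_of_noiseStable hh hδ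
    exact ⟨η, h1, h2, fun p hp hp' n => H p hp.le hp' n⟩
  | succ t =>
    obtain ⟨η, h1, h2, H⟩ := exists_noise_le_of_noiseStable hh (half_pos hδ)
    -- Chosen so that the affine bound, divided by `η`, adds exactly `a / η = δ / 2`.
    set a := δ * η / 2 with ha
    have hapos : 0 < a := by positivity
    obtain ⟨p₀, hp₀, hp₁, H'⟩ := exists_chainExp_frac_le t (by positivity : 0 < a * a)
    refine ⟨p₀, hp₀, hp₁, fun p h0 hp' n => ?_⟩
    have hp : p ∈ Set.Icc (0 : ℝ) 1 := ⟨h0.le, by linarith⟩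
    have hstep : ∀ D : Cube n, chainStep (disagree (h n)) D ≤
        (δ / 2 + 1 / η * (a / 2)) + 1 / η * (1 / (2 * a)) * frac D := by
      intro D
      -- Below level `η` stability of `h` gives `δ/2`; above it the trivial bound `1` is at most
      -- `phi / η`.
      have h3 : chainStep (disagree (h n)) D ≤ δ / 2 + 1 / η * phi (frac D) := by
        have hpn := phi_nonneg (frac D)
        rcases lt_or_ge (phi (frac D)) η with hlt | hge
        · have := H _ hpn hlt n
          have h4 : 0 ≤ 1 / η * phi (frac D) := by positivity
          rw [chainStep]
          linarith
        · have h4 := chainStep_le_one (disagree_le_one (h n)) D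
          have h5 : 1 ≤ 1 / η * phi (frac D) := by
            rw [one_div_mul_eq_div, one_le_div h1]; exact hge
          linarith
      have h6 := mul_le_mul_of_nonneg_left (phi_frac_le hapos D) (by positivity : 0 ≤ 1 / η)
      linarith
    have h7 := chainExp_mono hp t hstep
    rw [chainExp_add hp, chainExp_const hp, chainExp_const_mul] at h7
    rw [chainExp_succ]
    calc _ ≤ (δ / 2 + 1 / η * (a / 2)) + 1 / η * (1 / (2 * a)) * (a * a) :=
          h7.trans (by gcongr; exact H' p h0 hp' n)
      _ = δ := by rw [ha]; field_simp; ring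

theorem exists_chainExp_disagree_le_of_le {h : ∀ n, BoolFun n} (hh : NoiseStable h) (B : ℕ)
    {δ : ℝ} (hδ : 0 < δ) : ∃ p₀ : ℝ, 0 < p₀ ∧ p₀ ≤ 1 / 2 ∧ ∀ p, 0 < p → p < p₀ → ∀ n, ∀ T ≤ B,
      chainExp p T (disagree (h n)) ≤ δ := by
  induction B with
  | zero =>
    obtain ⟨p₀, h1, h2, H⟩ := exists_chainExp_disagree_le hh 0 hδ
    refine ⟨p₀, h1, h2, fun p hp hp' n T hT => ?_⟩
    rw [Nat.le_zero.1 hT]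
    exact H p hp hp' n
  | succ B ih =>
    obtain ⟨p₀, h1, h2, H⟩ := ih
    obtain ⟨p₁, h1', h2', H'⟩ := exists_chainExp_disagree_le hh (B + 1) hδ
    refine ⟨min p₀ p₁, lt_min h1 h1', (min_le_left _ _).trans h2, fun p hp hp' n T hT => ?_⟩
    have h3 := lt_min_iff.1 hp'
    rcases Nat.le_succ_iff.1 hT with h | h
    · exact H p hp h3.1 n T h
    · rw [h]; exact H' p hp h3.2 n

theorem annealedNoiseStable_of_bounded {T : ℕ → ℕ} {h : ∀ n, BoolFun n} {B : ℕ}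
    (hB : ∀ n, T n ≤ B) (hh : NoiseStable h) :
    AnnealedNoiseStable (fun n => netLaw (T n) (h n)) := by
  refine ENNReal.tendsto_nhds_zero.2 fun e he => ?_
  obtain ⟨δ, hδ0, hδe⟩ := ENNReal.lt_iff_exists_nnreal_btwn.1 he
  have hδ : (0 : ℝ) < δ := by exact_mod_cast hδ0
  obtain ⟨p₀, h1, h2, H⟩ := exists_chainExp_disagree_le_of_le hh B hδ
  filter_upwards [Ioo_mem_nhdsGT h1] with p hp
  refine iSup_le fun n => ?_
  rw [prod_noisePair_ne ⟨hp.1.le, by linarith [hp.2]⟩]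
  refine le_trans (ENNReal.ofReal_le_ofReal (H p hp.1 hp.2 n (T n) (hB n))) ?_
  rw [ENNReal.ofReal_coe_nnreal]
  exact hδe.le

theorem quenchedNoiseStable_of_bounded {T : ℕ → ℕ} {h : ∀ n, BoolFun n} {B : ℕ}
    (hB : ∀ n, T n ≤ B) (hh : NoiseStable h) :
    QuenchedNoiseStable (fun n => netLaw (T n) (h n)) := by
  intro δ hδ
  obtain ⟨p₀, h1, h2, H⟩ := exists_chainExp_disagree_le_of_le hh B (by positivity : 0 < δ * δ)
  have hp : p₀ / 2 ∈ Set.Icc (0 : ℝ) 1 := ⟨by linarith, by linarith⟩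
  refine ⟨p₀ / 2, by linarith, by linarith, fun n => ?_⟩
  refine one_sub_le_measureReal_lt (fun f => measureReal_nonneg) hδ ?_
  rw [integral_noisePair_real_ne hp]
  exact H _ (by linarith) (by linarith) n _ (hB n)

end SignNetwork

end

open SignNetwork
theorem mainTheorem2 :
    (∀ (ε K : ℕ → ℝ), (∀ n, ε n ≤ 1 / 2) → Antitone ε → Tendsto ε atTop (𝓝 0) →
      Tendsto (fun n : ℕ => (n : ℝ) * ε n) atTop atTop →
      Tendsto (fun n : ℕ => K n / Real.log (1 / ε n)) atTop atTop →
      -- moderate depth, arbitrary output functions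
      (∀ (b : ℕ → ℝ) (T : ℕ → ℕ) (h : ∀ n, BoolFun n),
        Tendsto b atTop (𝓝 0) → Tendsto (fun n : ℕ => (n : ℝ) * b n) atTop atTop →
        (∀ᶠ n : ℕ in atTop, K n ≤ (T n : ℝ) ∧ (T n : ℝ) ≤ Real.exp (b n * n)) →
        AnnealedQNS (fun n => netLaw (T n) (h n)) ε) ∧
      -- large depth, odd output functions (there are none for `n = 0`)
      (∀ (T : ℕ → ℕ) (h : ∀ n, BoolFun n),
        (∀ n, 1 ≤ n → ∀ ω, h n (-ω) = -h n ω) → (∀ᶠ n : ℕ in atTop, K n ≤ (T n : ℝ)) →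
        AnnealedQNS (fun n => netLaw (T n) (h n)) ε) ∧
      -- large depth, arbitrary output functions, quenched
      (∀ (T : ℕ → ℕ) (h : ∀ n, BoolFun n), (∀ᶠ n : ℕ in atTop, K n ≤ (T n : ℝ)) →
        QuenchedQNS (fun n => netLaw (T n) (h n)) ε)) ∧
    -- failure of annealed sensitivity for sufficiently fast growing depth
    (∃ (h : ∀ n, BoolFun n) (τ : ℕ → ℕ), ∀ T : ℕ → ℕ, (∀ᶠ n : ℕ in atTop, τ n ≤ T n) →
      ¬ AnnealedNoiseSensitive (fun n => netLaw (T n) (h n))) ∧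
    -- bounded depth, noise stable output functions
    (∀ (T : ℕ → ℕ) (h : ∀ n, BoolFun n), (∃ B, ∀ n, T n ≤ B) → NoiseStable h →
      AnnealedNoiseStable (fun n => netLaw (T n) (h n)) ∧
      QuenchedNoiseStable (fun n => netLaw (T n) (h n))) := by
  refine ⟨fun ε K hε _ h0 hn hK => ⟨fun b T h hb _ hT => ?_, fun T h hodd hT => ?_,
    fun T h hT => ?_⟩, exists_not_annealedNoiseSensitive, fun T h ⟨B, hB⟩ hh => ?_⟩
  · exact annealedQNS_of_le_exp hε h0 hn hK h hb hT
  · exact annealedQNS_of_odd hε h0 hn hK hodd hT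
  · exact quenchedQNS hε h0 hn hK h hT
  · exact ⟨annealedNoiseStable_of_bounded hB hh, quenchedNoiseStable_of_bounded hB hh⟩
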